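/- **Setting.** Let $X_{1,n},\dots,X_{n,n}$ ($n\ge 1$) be fixed predictors in a space $\mathcal X$. A tree fit is observed: its leaves $l_1,\dots,l_m$ partition $\mathcal X$, and the path to the leaf of interest $l_1$ consists of regions $p_1=\mathcal X,p_2,\dots,p_d$ and $p_{d+1}=l_1$. At $p_h$ there are $k_h\ge1$ candidate binary splits $s_h^1,\dots,s_h^{k_h}$; the split $s_h^k$ divides $p_h$ into $p_h^k$ and $p_h\setminus p_h^k$, and the observed split is $s_h^1$, with $p_h^1=p_{h+1}$. For $R\subseteq\mathcal X$ let $n_R=|\{i:X_{i,n}\in R\}|$, $n_1=n_{l_1}$, $\hat\pi_R=n_R^{-1}\sum_i Y_{i,n}\mathbf 1[X_{i,n}\in R]$. The outcomes $Y_{1,n},\dots,Y_{n,n}$ are independent, $Y_{i,n}\sim\mathrm{Bernoulli}(\theta_{i,n})$ with $\theta_{i,n}=\sum_{j=1}^m\pi_{j,n}\mathbf 1[X_{i,n}\in l_j]$, $\pi_{j,n}\in(0,1)$. Given an impurity function $\mathcal I$ and constants $\epsilon_1,\dots,\epsilon_d$, the information gain of a split of $P$ into $C$ and $P\setminus C$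 is $\mathcal I(\hat\pi_P)-\frac{n_C}{n_P}\mathcal I(\hat\pi_C)-\frac{n_{P\setminus C}}{n_P}\mathcal I(\hat\pi_{P\setminus C})$. Given $Y$, the random splits $S_1,\dots,S_d$ drawn at $p_1,\dots,p_d$ are independent, and $S_h=s_h^k$ with probability proportional to $\exp(\epsilon_h G_h^k)$, where $G_h^k$ is the gain of $s_h^k$ (exponential mechanism). Let $\{\mathbf S_1=\mathbf s_1\}=\bigcap_{h}\{S_h=s_h^1\}$. The key statistics are $\hat T_{n,1}=\sqrt{n_1}\,\hat\pi_{l_1}$ and the vector $\hat T_{n,-1}$ with entries $\hat\pi_{-1}(p_h)$ and $\hat\pi_{-1}(p_h^k)$, $2\le k\le k_h$, $1\le h\le d$, where $\hat\pi_{-1}(R)=\sqrt{n_R}\,\hat\pi_R-\frac{n_{R\cap l_1}}{\sqrt{n_1n_R}}\sqrt{n_1}\,\hat\pi_{l_1}$; let $\Sigma_n$ be the covariance matrix of $\hat T_n=(\hat T_{n,1},\hat T_{n,-1})$. Since $\hat\pi_{-1}(l_1)=0$, the relation $\hat\pi_R=\frac{n_{R\cap l_1}}{n_R\sqrt{n_1}}\hat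 T_{n,1}+\frac{1}{\sqrt{n_R}}\hat\pi_{-1}(R)$ expresses $\hat\pi_{p_h}$ and $\hat\pi_{p_h^k}$, and hence also $\hat\pi_{p_h\setminus p_h^k}=(n_{p_h}\hat\pi_{p_h}-n_{p_h^k}\hat\pi_{p_h^k})/(n_{p_h}-n_{p_h^k})$, as linear functions of $\hat T_n$. Let $\tilde D_n$ be the set of points $(u,v)$ at which all these linear functions take values in $(0,1)$. On $\tilde D_n$ let $\mathcal G_h^k(u,v)$ be the gain $G_h^k$ rewritten, through these linear functions, as a function of the value $(u,v)$ of $(\hat T_{n,1},\hat T_{n,-1})$, and let $\lambda_h(u,v)=e^{\epsilon_h\mathcal G_h^1(u,v)}/\sum_{k}e^{\epsilon_h\mathcal G_h^k(u,v)}$; put $\lambda_h=0$ outside $\tilde D_n$. With $\phi(\cdot;\mu,\sigma^2)$ the normal density, $\Pi_{n,1}=\sqrt{n_1}\,\pi_{1,n}$ and $\sigma_{n,1}^2=\pi_{1,n}(1-\pi_{1,n})$, put $$\mathrm{Pivot}(\hat T_{n,1};\Pi_{n,1},\sigma^2)=\frac{\int_{-\infty}^{\hat T_{n,1}}\phi(u;\Pi_{n,1},\sigma^2)\prod_{h=1}^d\lambda_h(u,\hat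 T_{n,-1})\,du}{\int_{-\infty}^{\infty}\phi(u;\Pi_{n,1},\sigma^2)\prod_{h=1}^d\lambda_h(u,\hat T_{n,-1})\,du}.$$ **Assumptions.** (1) $\lim_{n\to\infty} n/n_R$ exists and is finite for $R=l_1$ and for all $R=p_h^k$ and $R=p_h\setminus p_h^k$. (2) $\liminf_n\pi_{j,n}>0$ and $\limsup_n\pi_{j,n}<1$ for every $j$. (3) There are $b,B>0$ such that, for all sufficiently large $n$, all eigenvalues of $\Sigma_n$ lie strictly between $1/b^2$ and $B^2$. (4) $\mathcal I$ is bounded and three times differentiable on $(0,1)$, with bounded derivatives of orders one to three. (Its values at $0$ and $1$ are arbitrary real numbers.) **Theorem.** Under (1)–(4), let $\hat\sigma_{n,1}^2$ be real random variables with $\hat\sigma_{n,1}^2-\sigma_{n,1}^2\to0$ in probability, unconditionally. Then: (i) for every $\delta>0$, $\displaystyle\lim_{n\to\infty}\mathbb P\big(|\hat\sigma_{n,1}^2-\sigma_{n,1}^2|>\delta\mid\mathbf S_1=\mathbf s_1\big)=0$; (ii) conditionally on $\{\mathbf S_1=\mathbf s_1\}$, $\mathrm{Pivot}(\hat T_{n,1};\Pi_{n,1},\hat\sigma_{n,1}^2)$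 converges in distribution to $\mathrm{Uniform}[0,1]$. (Where $\hat\sigma_{n,1}^2\le0$ or the denominator vanishes, an event of vanishing conditional probability, the pivot may be given any fixed convention.) -/

import Mathlib

open MeasureTheory ProbabilityTheory Filter Topology
open scoped ENNReal

namespace TreeInference

noncomputable section

/-! ### Sample proportions, information gain, exponential mechanism -/

section Sample

variable {𝒳 : Type*} {n : ℕ}

open Classical in
/-- `n_R`: the number of observations whose predictor lies in the region `R`. -/
def count (x : Fin n → 𝒳) (R : Set 𝒳) : ℕ := (Finset.univ.filter fun i => x i ∈ R).card

open Classical in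
/-- The sample proportion of the region `R`: the average of the binary outcomes over `R`. -/
def prop (x : Fin n → 𝒳) (y : Fin n → Bool) (R : Set 𝒳) : ℝ :=
  (1 / (count x R : ℝ)) * ∑ i, ((y i).toNat : ℝ) * (if x i ∈ R then 1 else 0)

/-- Information gain `G_P(s; y)` of the split of the region `P` into `C` and `P \ C`, for the
impurity measure `I(R; y) = I (prop x y R)`. -/
def gain (I : ℝ → ℝ) (x : Fin n → 𝒳) (y : Fin n → Bool) (P C : Set 𝒳) : ℝ :=
  I (prop x y P) -
    ((count x C : ℝ) / count x P * I (prop x y C) +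
      (count x (P \ C) : ℝ) / count x P * I (prop x y (P \ C)))

/-- Exponential mechanism: the probability of selecting the `j`-th of the candidate splits
`P = C k ∪ (P \ C k)` of the region `P`, given the outcomes `y`. -/
def splitProb {K : ℕ} (I : ℝ → ℝ) (ε : ℝ) (x : Fin n → 𝒳) (y : Fin n → Bool) (P : Set 𝒳)
    (C : Fin K → Set 𝒳) (j : Fin K) : ℝ :=
  Real.exp (ε * gain I x y P (C j)) / ∑ k, Real.exp (ε * gain I x y P (C k))

/-- The orthogonalized proportion `√n_R π̂_R - n_{R ∩ l} / √(n_l n_R) * (√n_l π̂_l)`. -/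
def orthProp (x : Fin n → 𝒳) (y : Fin n → Bool) (l R : Set 𝒳) : ℝ :=
  √(count x R) * prop x y R -
    (count x (R ∩ l) : ℝ) / √((count x l : ℝ) * count x R) * (√(count x l) * prop x y l)

/-- The scaling vector of the split of `P` into `C` and `P \ C` (entries numbered from 0). -/
def scaling (x : Fin n → 𝒳) (l P C : Set 𝒳) : Fin 8 → ℝ :=
  ![√(count x l) / count x P,
    1 / √(count x P),
    (count x (C ∩ l) : ℝ) / (count x C * √(count x l)),
    1 / √(count x C),
    ((count x (P ∩ l) : ℝ) - count x (C ∩ l)) / (((count x P : ℝ) - count x C) * √(count x l)),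
    √(count x P) / ((count x P : ℝ) - count x C),
    -(√(count x C) / ((count x P : ℝ) - count x C)),
    (count x C : ℝ) / count x P]

end Sample

/-- The set `D(η)` of points at which the three arguments of the information measure lie
in `(0, 1)`. -/
def scaledDomain (η : Fin 8 → ℝ) : Set (ℝ × ℝ × ℝ) :=
  {w | η 0 * w.1 + η 1 * w.2.1 ∈ Set.Ioo (0 : ℝ) 1 ∧
    η 2 * w.1 + η 3 * w.2.2 ∈ Set.Ioo (0 : ℝ) 1 ∧
    η 4 * w.1 + η 5 * w.2.1 + η 6 * w.2.2 ∈ Set.Ioo (0 : ℝ) 1}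

/-- The map `g_η(x, y, z)`. -/
def scaledGain (I : ℝ → ℝ) (η : Fin 8 → ℝ) (w : ℝ × ℝ × ℝ) : ℝ :=
  I (η 0 * w.1 + η 1 * w.2.1) - η 7 * I (η 2 * w.1 + η 3 * w.2.2) -
    (1 - η 7) * I (η 4 * w.1 + η 5 * w.2.1 + η 6 * w.2.2)

/-! ### The observed tree fit -/

/-- An observed tree fit on the predictor space `𝒳`, seen from one of its leaves: the partition of
`𝒳` into leaves, the path of internal regions `p_1 = 𝒳, …, p_d` that leads to the leaf of interest
`leaf 0`, and the candidate splits of each region on that path. A candidate binary split of `p_h` is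
given by one of its two subregions, the other one being the complement in `p_h`. Candidate `0` is
the observed split, and its subregion is the next region on the path. -/
structure TreeFit (𝒳 : Type*) where
  /-- the number of leaves, minus one -/
  m : ℕ
  leaf : Fin (m + 1) → Set 𝒳
  leaf_disjoint : Pairwise fun i j => Disjoint (leaf i) (leaf j)
  leaf_cover : ⋃ j, leaf j = Set.univ
  /-- the number of splits on the path to the leaf of interest -/
  d : ℕ
  node : Fin (d + 1) → Set 𝒳
  node_root : node 0 = Set.univ
  node_last : node (Fin.last d) = leaf 0
  /-- the number of candidate splits at each region of the path, minus one -/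
  k : Fin d → ℕ
  cand : (h : Fin d) → Fin (k h + 1) → Set 𝒳
  cand_subset : ∀ h j, cand h j ⊆ node h.castSucc
  cand_zero : ∀ h, cand h 0 = node h.succ

namespace TreeFit

variable {𝒳 : Type*} (t : TreeFit 𝒳) {n : ℕ}

/-- Positions in the vectors `v = (v^h, v^{h,k})`: position `⟨h, 0⟩` belongs to the internal region
`p_h`, and `⟨h, j⟩` with `j ≠ 0` to the candidate region `cand h j`. -/
abbrev Idx : Type := Σ h : Fin t.d, Fin (t.k h + 1)

/-- The key statistics other than the first one. -/
def restStat (x : Fin n → 𝒳) (y : Fin n → Bool) (i : t.Idx) : ℝ :=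
  orthProp x y (t.leaf 0) (if i.2 = 0 then t.node i.1.castSucc else t.cand i.1 i.2)

/-- The first key statistic `√n_1 π̂_1`. -/
def mainStat (x : Fin n → 𝒳) (y : Fin n → Bool) : ℝ :=
  √(count x (t.leaf 0)) * prop x y (t.leaf 0)

/-- The whole vector of key statistics; `none` is the position of the first one. -/
def keyStat (x : Fin n → 𝒳) (y : Fin n → Bool) : Option t.Idx → ℝ
  | none => t.mainStat x y
  | some i => t.restStat x y i

/-- The entry of `v` that belongs to the subregion `cand h j`: it is `v^{h,j}` for `j ≠ 0`, and
`v^{h+1}` for the observed split, where `v^{d+1} = 0` since the orthogonalized proportion of the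
leaf of interest itself is `0`. -/
def childEntry (v : t.Idx → ℝ) (h : Fin t.d) (j : Fin (t.k h + 1)) : ℝ :=
  if j = 0 then
    if hlt : h.val + 1 < t.d then v ⟨⟨h.val + 1, hlt⟩, 0⟩ else 0
  else v ⟨h, j⟩

/-- The scaling vector of the `j`-th candidate split at `p_h`. -/
def eta (x : Fin n → 𝒳) (h : Fin t.d) (j : Fin (t.k h + 1)) : Fin 8 → ℝ :=
  scaling x (t.leaf 0) (t.node h.castSucc) (t.cand h j)

/-- The information gain of the `j`-th candidate split at `p_h` as a function of the values `(u, v)`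
of the key statistics. -/
def gainFn (I : ℝ → ℝ) (x : Fin n → 𝒳) (h : Fin t.d) (j : Fin (t.k h + 1)) (u : ℝ)
    (v : t.Idx → ℝ) : ℝ :=
  scaledGain I (t.eta x h j) (u, v ⟨h, 0⟩, t.childEntry v h j)

/-- The common domain of the gains. -/
def domain (x : Fin n → 𝒳) : Set (ℝ × (t.Idx → ℝ)) :=
  {w | ∀ (h : Fin t.d) (j : Fin (t.k h + 1)),
    (w.1, w.2 ⟨h, 0⟩, t.childEntry w.2 h j) ∈ scaledDomain (t.eta x h j)}

open Classical in
/-- The correction factor `λ_h(u, v)`, extended by `0` outside the domain. -/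
def lam (I : ℝ → ℝ) (ε : Fin t.d → ℝ) (x : Fin n → 𝒳) (h : Fin t.d) (u : ℝ)
    (v : t.Idx → ℝ) : ℝ :=
  if (u, v) ∈ t.domain x then
    Real.exp (ε h * t.gainFn I x h 0 u v) / ∑ j, Real.exp (ε h * t.gainFn I x h j u v)
  else 0

/-- The unnormalized density `φ(u; mean, σ2) ∏_h λ_h(u, v)`. -/
def pivotDensity (I : ℝ → ℝ) (ε : Fin t.d → ℝ) (x : Fin n → 𝒳) (v : t.Idx → ℝ)
    (mean σ2 u : ℝ) : ℝ :=
  gaussianPDFReal mean σ2.toNNReal u * ∏ h, t.lam I ε x h u v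

/-- The pivot, at the value `s` of the first and `v` of the other key statistics. -/
def pivot (I : ℝ → ℝ) (ε : Fin t.d → ℝ) (x : Fin n → 𝒳) (s : ℝ) (v : t.Idx → ℝ)
    (mean σ2 : ℝ) : ℝ :=
  (∫ u in Set.Iic s, t.pivotDensity I ε x v mean σ2 u) /
    ∫ u, t.pivotDensity I ε x v mean σ2 u

open Classical in
/-- The success probability `θ_i = ∑_j π_j 1[X_i ∈ l_j]`. -/
def theta (x : Fin n → 𝒳) (π : Fin (t.m + 1) → ℝ) (i : Fin n) : ℝ :=
  ∑ j, π j * (if x i ∈ t.leaf j then 1 else 0)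

/-- The model for the outcomes `Y` and for the random splits `S h` drawn at the regions of the path:
the outcomes are independent Bernoulli variables with means `theta`, and, given the outcomes, the
splits are independent and follow the exponential mechanism. -/
structure IsModel {Ω : Type*} [MeasurableSpace Ω] (P : Measure Ω) (I : ℝ → ℝ) (ε : Fin t.d → ℝ)
    (x : Fin n → 𝒳) (π : Fin (t.m + 1) → ℝ) (Y : Fin n → Ω → Bool)
    (S : (h : Fin t.d) → Ω → Fin (t.k h + 1)) : Prop where
  isProb : IsProbabilityMeasure P
  param_mem : ∀ j, π j ∈ Set.Ioo (0 : ℝ) 1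
  measurable_Y : ∀ i, Measurable (Y i)
  measurable_S : ∀ h, Measurable (S h)
  indep : iIndepFun Y P
  bernoulli : ∀ i, P.real {ω | Y i ω = true} = t.theta x π i
  mechanism : ∀ (y : Fin n → Bool) (s : (h : Fin t.d) → Fin (t.k h + 1)),
    P.real {ω | (∀ i, Y i ω = y i) ∧ ∀ h, S h ω = s h} =
      P.real {ω | ∀ i, Y i ω = y i} *
        ∏ h, splitProb I (ε h) x y (t.node h.castSucc) (t.cand h) (s h)

/-- The event that the splits drawn along the path are the observed ones. -/
def observed {Ω : Type*} (S : (h : Fin t.d) → Ω → Fin (t.k h + 1)) : Set Ω :=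
  {ω | ∀ h, S h ω = 0}

/-- The covariance matrix of the vector of key statistics. -/
def covMat {Ω : Type*} [MeasurableSpace Ω] (P : Measure Ω) (x : Fin n → 𝒳)
    (Y : Fin n → Ω → Bool) : Matrix (Option t.Idx) (Option t.Idx) ℝ :=
  Matrix.of fun i j =>
    cov[fun ω => t.keyStat x (fun l => Y l ω) i, fun ω => t.keyStat x (fun l => Y l ω) j; P]

/-! ### Assumptions -/

/-- The sample sizes of the leaf of interest and of all candidate subregions along the path grow
proportionally to `n`: `lim n / n_R < ∞`. -/
def ProportionalGrowth (X : (n : ℕ) → Fin n → 𝒳) : Prop :=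
  ∀ R : Set 𝒳, (R = t.leaf 0 ∨ ∃ h j, R = t.cand h j ∨ R = t.node h.castSucc \ t.cand h j) →
    ∃ c : ℝ≥0∞, c < ∞ ∧ Tendsto (fun n : ℕ => (n : ℝ≥0∞) / (count (X n) R : ℝ≥0∞)) atTop (𝓝 c)

/-- The leaf parameters are bounded away from `0` and `1`. -/
def ParamsBounded (π : ℕ → Fin (t.m + 1) → ℝ) : Prop :=
  ∀ j, 0 < liminf (fun n => π n j) atTop ∧ limsup (fun n => π n j) atTop < 1

/-- The eigenvalues of the covariance matrices of the key statistics are, for all sufficiently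
large `n`, bounded away from `0` and `∞`. -/
def CovNondegenerate {Ω : ℕ → Type*} [∀ n, MeasurableSpace (Ω n)] (P : ∀ n, Measure (Ω n))
    (X : (n : ℕ) → Fin n → 𝒳) (Y : ∀ n, Fin n → Ω n → Bool) : Prop :=
  ∃ b B : ℝ, 0 < b ∧ 0 < B ∧ ∀ᶠ n in atTop, ∀ μ : ℝ,
    Module.End.HasEigenvalue (Matrix.toLin' (t.covMat (P n) (X n) (Y n))) μ →
      1 / b ^ 2 < μ ∧ μ < B ^ 2

end TreeFit

/-- The information measure is bounded and three times differentiable on `(0, 1)`, with bounded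
derivatives of orders one to three. -/
def SmoothInformation (I : ℝ → ℝ) : Prop :=
  (∀ r < 3, DifferentiableOn ℝ (iteratedDeriv r I) (Set.Ioo 0 1)) ∧
    ∀ r ≤ 3, ∃ C : ℝ, ∀ x ∈ Set.Ioo (0 : ℝ) 1, |iteratedDeriv r I x| ≤ C

end

end TreeInference

/-! The correction factor becomes flat in the limit. Keep the orthogonalized proportions fixed and
move the first key statistic by a bounded amount `u`: each proportion then moves by at most `|u| /
√n_1` (`abs_shifted_sub_le`). By Chebyshev the proportions themselves stay close to their means,
which are bounded away from 0 and 1 because they average the leaf parameters. Since the impurity is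
uniformly continuous on compact subintervals of (0, 1), `∏ λ_h` is therefore, on any window `|u - Π|
≤ L` and with high probability, close to a deterministic number `c_n`: the selection probability at
the mean proportions (`abs_prod_lam_sub_le`). Boundedness of the impurity keeps `c_n`, and the
probability of the observed splits, above some `c₀ > 0` that does not depend on `n`
(`exists_le_selProb`).

Three consequences carry the theorem. Conditional probabilities are at most `1 / c₀` times the
unconditional ones (`IsModel.cond_real_le`); this is (i), and it carries every negligible event over
to the conditional law. In the pivot the nearly constant factor cancels between numerator and
denominator, so the pivot is close to `Φ((T - Π) / σ̂)`, hence to `Φ((T - Π) / σ)`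
(`tendsto_pivot_sub_stdCDF`). Finally, the selection probability given the outcomes is nearly
constant in mean, so conditioning hardly changes characteristic functions
(`IsModel.norm_integral_cond_sub_le`), and the central limit theorem for the binomial count in the
leaf persists conditionally (`tendstoInDistribution_standardized`).

Thus `Φ((T - Π) / σ)` converges conditionally to `Φ` of a standard normal variable, which is uniform
(`map_stdCDF`), and Slutsky's theorem passes this limit on to the pivot. -/

namespace TreeInference

noncomputable section

/-! ### The standard normal distribution function -/

/-- The distribution function of the standard normal law. -/
def stdCDF (x : ℝ) : ℝ := (gaussianReal 0 1).real (Set.Iic x)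

lemma stdCDF_eq_cdf : stdCDF = cdf (gaussianReal 0 1) := by
  ext x
  rw [stdCDF, cdf_eq_real]

lemma gaussianPDFReal_std_le_one (x : ℝ) : gaussianPDFReal 0 1 x ≤ 1 := by
  rw [gaussianPDFReal]
  have h1 : (√(2 * Real.pi * ((1 : NNReal) : ℝ)))⁻¹ ≤ 1 := by
    apply inv_le_one_of_one_le₀
    rw [Real.one_le_sqrt]
    have := Real.pi_gt_three
    simp; linarith
  have h2 : Real.exp (-(x - 0) ^ 2 / (2 * ((1 : NNReal) : ℝ))) ≤ 1 := by
    rw [Real.exp_le_one_iff]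
    simp only [NNReal.coe_one]
    nlinarith [sq_nonneg (x - 0)]
  exact mul_le_one₀ h1 (Real.exp_pos _).le h2

lemma stdCDF_sub {x y : ℝ} (h : x ≤ y) :
    stdCDF y - stdCDF x = (gaussianReal 0 1).real (Set.Ioc x y) := by
  have hd : Set.Ioc x y = Set.Iic y \ Set.Iic x := by
    ext; simp [and_comm]
  rw [hd, measureReal_sdiff (Set.Iic_subset_Iic.2 h) measurableSet_Iic, stdCDF, stdCDF]

lemma stdCDF_strictMono : StrictMono stdCDF := by
  intro x y h
  rw [← sub_pos, stdCDF_sub h.le]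
  have h0 : (gaussianReal 0 1) (Set.Ioc x y) ≠ 0 := fun h0 => by
    have := gaussianReal_absolutelyContinuous' 0 one_ne_zero h0
    simp at this
    linarith
  exact ENNReal.toReal_pos h0 (measure_ne_top _ _)

lemma stdCDF_sub_le {x y : ℝ} (h : x ≤ y) : stdCDF y - stdCDF x ≤ y - x := by
  rw [stdCDF_sub h, Measure.real, gaussianReal_apply_eq_integral _ one_ne_zero,
    ENNReal.toReal_ofReal (integral_nonneg fun u => gaussianPDFReal_nonneg _ _ _)]
  calc ∫ u in Set.Ioc x y, gaussianPDFReal 0 1 u ≤ ∫ u in Set.Ioc x y, (1 : ℝ) :=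
        setIntegral_mono (integrable_gaussianPDFReal 0 1).integrableOn (by simp)
          gaussianPDFReal_std_le_one
    _ = y - x := by simp [h]

lemma abs_stdCDF_sub_le (x y : ℝ) : |stdCDF x - stdCDF y| ≤ |x - y| := by
  rcases le_total x y with h | h
  · rw [abs_sub_comm, abs_sub_comm x, abs_of_nonneg (sub_nonneg.2 (stdCDF_strictMono.monotone h)),
      abs_of_nonneg (sub_nonneg.2 h)]
    exact stdCDF_sub_le h
  · rw [abs_of_nonneg (sub_nonneg.2 (stdCDF_strictMono.monotone h)),
      abs_of_nonneg (sub_nonneg.2 h)]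
    exact stdCDF_sub_le h

lemma continuous_stdCDF : Continuous stdCDF :=
  (LipschitzWith.of_dist_le_mul (K := 1) fun x y => by
    simpa [Real.dist_eq] using abs_stdCDF_sub_le x y).continuous

lemma stdCDF_nonneg (x : ℝ) : 0 ≤ stdCDF x := measureReal_nonneg

lemma stdCDF_le_one (x : ℝ) : stdCDF x ≤ 1 := measureReal_le_one

/-- The probability integral transform of the standard normal law is uniform. -/
lemma map_stdCDF :
    (gaussianReal 0 1).map stdCDF = (volume : Measure ℝ).restrict (Set.Icc 0 1) := by
  have := Measure.isProbabilityMeasure_map (μ := gaussianReal 0 1)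
    continuous_stdCDF.measurable.aemeasurable
  refine Measure.ext_of_Iic _ _ fun a => ?_
  rw [Measure.map_apply continuous_stdCDF.measurable measurableSet_Iic,
    Measure.restrict_apply measurableSet_Iic]
  rcases le_or_gt a 0 with ha | ha
  · have h1 : stdCDF ⁻¹' Set.Iic a = ∅ := by
      ext x
      have := stdCDF_strictMono (sub_one_lt x)
      have := stdCDF_nonneg (x - 1)
      simp; linarith
    have h2 : Set.Iic a ∩ Set.Icc 0 1 ⊆ {0} := fun x hx => by
      have h3 := hx.1
      have h4 := hx.2.1
      simp at h3 ⊢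
      linarith
    rw [h1, measure_empty, measure_mono_null h2 (by simp)]
  rcases le_or_gt 1 a with ha1 | ha1
  · have h1 : stdCDF ⁻¹' Set.Iic a = Set.univ := by
      ext x
      have := stdCDF_le_one x
      simp; linarith
    have h2 : Set.Iic a ∩ Set.Icc 0 1 = Set.Icc 0 1 :=
      Set.inter_eq_right.2 fun x hx => hx.2.trans ha1
    rw [h1, h2]; simp
  · obtain ⟨z, hz⟩ : ∃ z, stdCDF z = a := by
      have h0 := tendsto_cdf_atBot (gaussianReal 0 1)
      have h1 := tendsto_cdf_atTop (gaussianReal 0 1)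
      rw [← stdCDF_eq_cdf] at h0 h1
      obtain ⟨x, hx⟩ := (h0.eventually (gt_mem_nhds ha)).exists
      obtain ⟨y, hy⟩ := (h1.eventually (lt_mem_nhds ha1)).exists
      exact mem_range_of_exists_le_of_exists_ge continuous_stdCDF ⟨x, hx.le⟩ ⟨y, hy.le⟩
    have h1 : stdCDF ⁻¹' Set.Iic a = Set.Iic z := by
      ext x
      simp [← hz, stdCDF_strictMono.le_iff_le]
    have h2 : Set.Iic a ∩ Set.Icc 0 1 = Set.Icc 0 a := by
      ext x; simp only [Set.mem_inter_iff, Set.mem_Iic, Set.mem_Icc]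
      constructor
      · exact fun h => ⟨h.2.1, h.1⟩
      · exact fun h => ⟨h.2, h.1, h.2.trans ha1.le⟩
    rw [h1, h2, Real.volume_Icc, sub_zero, ← hz, stdCDF, ofReal_measureReal]

lemma gaussianReal_real_Iic (m : ℝ) {v : NNReal} (hv : v ≠ 0) (s : ℝ) :
    (gaussianReal m v).real (Set.Iic s) = stdCDF ((s - m) / √v) := by
  have hv' : (0 : ℝ) < √v := Real.sqrt_pos.2 (by positivity)
  have h : gaussianReal m v = ((gaussianReal 0 1).map (√v * ·)).map (· + m) := by
    rw [gaussianReal_map_const_mul, gaussianReal_map_add_const]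
    congr 1
    · simp
    · ext; simp
  rw [h, Measure.map_map (by fun_prop) (by fun_prop), stdCDF, map_measureReal_apply (by fun_prop)
    measurableSet_Iic]
  congr 1
  ext x
  simp only [Set.mem_preimage, Function.comp, Set.mem_Iic]
  rw [le_div_iff₀ hv', mul_comm]
  constructor <;> intro h <;> linarith

/-! ### Tilting a normal law by an almost constant factor -/

lemma integral_gaussianPDFReal_mul (m : ℝ) {v : NNReal} (hv : v ≠ 0) (f : ℝ → ℝ) :
    ∫ u, gaussianPDFReal m v u * f u = ∫ u, f u ∂gaussianReal m v := by
  rw [integral_gaussianReal_eq_integral_smul hv]; rfl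

lemma setIntegral_gaussianPDFReal_mul (m : ℝ) {v : NNReal} (hv : v ≠ 0) (f : ℝ → ℝ) {A : Set ℝ}
    (hA : MeasurableSet A) :
    ∫ u in A, gaussianPDFReal m v u * f u = ∫ u in A, f u ∂gaussianReal m v := by
  rw [← integral_indicator hA, ← integral_indicator hA, ← integral_gaussianPDFReal_mul m hv]
  congr 1
  ext u
  by_cases hu : u ∈ A <;> simp [hu]

/-- Inside the window the integrand is at most `ω`; outside it is at most 1, as `Λ` and `c` both lie
in [0, 1], and Chebyshev bounds the mass there by `v / L ^ 2`. -/
lemma integral_abs_sub_gaussianReal_le {m : ℝ} {v : NNReal} {Λ : ℝ → ℝ} {c ω L : ℝ}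
    (hΛ : Measurable Λ) (hΛ0 : ∀ u, 0 ≤ Λ u) (hΛ1 : ∀ u, Λ u ≤ 1)
    (hc0 : 0 ≤ c) (hc1 : c ≤ 1) (hL : 0 < L) (hω : 0 ≤ ω) (h : ∀ u, |u - m| ≤ L → |Λ u - c| ≤ ω) :
    ∫ u, |Λ u - c| ∂gaussianReal m v ≤ ω + v / L ^ 2 := by
  set A : Set ℝ := {u | L ≤ |u - m|} with hA
  have hAm : MeasurableSet A := measurableSet_le measurable_const (by fun_prop)
  have hch : (gaussianReal m v).real A ≤ v / L ^ 2 := by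
    have := meas_ge_le_variance_div_sq (μ := gaussianReal m v) (X := id)
      (memLp_id_gaussianReal 2) hL
    rw [variance_id_gaussianReal] at this
    simp only [id, integral_id_gaussianReal] at this
    exact ENNReal.toReal_le_of_le_ofReal (by positivity) this
  have habs : ∀ u, |Λ u - c| ≤ 1 := fun u => abs_sub_le_iff.2
    ⟨by linarith [hΛ1 u], by linarith [hΛ0 u]⟩
  calc ∫ u, |Λ u - c| ∂gaussianReal m v
      ≤ ∫ u, (ω + A.indicator 1 u) ∂gaussianReal m v := by
        refine integral_mono ?_ ?_ fun u => ?_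
        · refine Integrable.of_bound (C := 1) (by fun_prop) (ae_of_all _ fun u => ?_)
          simpa using habs u
        · exact (integrable_const _).add ((integrable_const 1).indicator hAm)
        · by_cases hu : u ∈ A
          · simp [hu]; linarith [habs u]
          · simp [hu]; exact h u (not_le.1 hu).le
    _ = ω + (gaussianReal m v).real A := by
        rw [integral_add (integrable_const _) ((integrable_const 1).indicator hAm)]
        simp [integral_indicator_one hAm]
    _ ≤ _ := by linarith

/-- A ratio of normal integrals tilted by an almost constant factor is close to the normal
distribution function. -/
lemma abs_tilted_ratio_sub_stdCDF_le {m s : ℝ} {v : NNReal} (hv : v ≠ 0) {Λ : ℝ → ℝ}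
    {c₀ c ω L : ℝ} (hΛ : Measurable Λ) (hΛ0 : ∀ u, 0 ≤ Λ u) (hΛ1 : ∀ u, Λ u ≤ 1)
    (hc₀ : 0 < c₀) (hc : c₀ ≤ c) (hc1 : c ≤ 1) (hL : 0 < L) (hω : 0 ≤ ω)
    (h : ∀ u, |u - m| ≤ L → |Λ u - c| ≤ ω) (he : ω + v / L ^ 2 ≤ c₀ / 2) :
    |(∫ u in Set.Iic s, gaussianPDFReal m v u * Λ u) / (∫ u, gaussianPDFReal m v u * Λ u) -
        stdCDF ((s - m) / √v)| ≤ 4 * (ω + v / L ^ 2) / c₀ := by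
  set e := ω + v / L ^ 2 with he_def
  have hint : Integrable Λ (gaussianReal m v) :=
    Integrable.of_bound (C := 1) hΛ.aestronglyMeasurable
      (ae_of_all _ fun u => by simpa [abs_of_nonneg (hΛ0 u)] using hΛ1 u)
  have hintc : Integrable (fun u => Λ u - c) (gaussianReal m v) := hint.sub (integrable_const _)
  have hmain := integral_abs_sub_gaussianReal_le (v := v) hΛ hΛ0 hΛ1 (hc₀.le.trans hc) hc1 hL hω h
  rw [setIntegral_gaussianPDFReal_mul m hv _ measurableSet_Iic, integral_gaussianPDFReal_mul m hv,
    ← gaussianReal_real_Iic m hv]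
  set N := ∫ u in Set.Iic s, Λ u ∂gaussianReal m v
  set D := ∫ u, Λ u ∂gaussianReal m v
  set F := (gaussianReal m v).real (Set.Iic s)
  have hN : |N - c * F| ≤ e := by
    have : N - c * F = ∫ u in Set.Iic s, (Λ u - c) ∂gaussianReal m v := by
      rw [integral_sub hint.integrableOn (integrable_const _)]
      simp [N, F, mul_comm]
    rw [this]
    calc |∫ u in Set.Iic s, (Λ u - c) ∂gaussianReal m v|
        ≤ ∫ u in Set.Iic s, |Λ u - c| ∂gaussianReal m v := abs_integral_le_integral_abs
      _ ≤ ∫ u, |Λ u - c| ∂gaussianReal m v :=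
          setIntegral_le_integral hintc.abs (ae_of_all _ fun u => abs_nonneg _)
      _ ≤ e := hmain
  have hD : |D - c| ≤ e := by
    have : D - c = ∫ u, (Λ u - c) ∂gaussianReal m v := by
      rw [integral_sub hint (integrable_const _)]
      simp [D]
    rw [this]
    exact abs_integral_le_integral_abs.trans hmain
  have hF0 : 0 ≤ F := measureReal_nonneg
  have hF1 : F ≤ 1 := measureReal_le_one
  have hDpos : c₀ / 2 ≤ D := by
    have := (abs_le.1 hD).1
    linarith
  have hD0 : 0 < D := by linarith
  -- The constant `c` drops out of `N - F * D`: only the errors `N - c F` and `D - c` remain, each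
  -- at most `e`. Division by `D ≥ c₀ / 2` then gives the factor 4.
  have hnum : |N - F * D| ≤ 2 * e := by
    have : N - F * D = (N - c * F) - F * (D - c) := by ring
    rw [this]
    refine (abs_sub _ _).trans ?_
    rw [abs_mul, abs_of_nonneg hF0]
    nlinarith [abs_nonneg (D - c)]
  have : N / D - F = (N - F * D) / D := by field_simp
  rw [this, abs_div, abs_of_pos hD0, div_le_div_iff₀ hD0 hc₀]
  have he0 : 0 ≤ e := (abs_nonneg _).trans hD
  nlinarith [abs_nonneg (N - F * D)]

/-! ### Products of softmax probabilities -/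

section Softmax

variable {d : ℕ} {k : Fin d → ℕ}

/-- The probability that independent exponential mechanisms with utilities `g h` all select
candidate `0`. -/
def softProd (ε : Fin d → ℝ) (g : (h : Fin d) → Fin (k h + 1) → ℝ) : ℝ :=
  ∏ h, Real.exp (ε h * g h 0) / ∑ j, Real.exp (ε h * g h j)

lemma softProd_factor_pos (ε : Fin d → ℝ) (g : (h : Fin d) → Fin (k h + 1) → ℝ) (h : Fin d) :
    0 < Real.exp (ε h * g h 0) / ∑ j, Real.exp (ε h * g h j) := by positivity

lemma softProd_pos (ε : Fin d → ℝ) (g : (h : Fin d) → Fin (k h + 1) → ℝ) : 0 < softProd ε g :=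
  Finset.prod_pos fun h _ => softProd_factor_pos ε g h

lemma softProd_le_one (ε : Fin d → ℝ) (g : (h : Fin d) → Fin (k h + 1) → ℝ) :
    softProd ε g ≤ 1 := by
  refine Finset.prod_le_one (fun h _ => (softProd_factor_pos ε g h).le) fun h _ => ?_
  rw [div_le_one (by positivity)]
  exact Finset.single_le_sum (f := fun j => Real.exp (ε h * g h j))
    (fun j _ => (Real.exp_pos _).le) (Finset.mem_univ 0)

/-- Each exponent changes by at most `|ε h| τ`, so the numerator and the denominator of each factor
change by at most the ratio `exp (|ε h| τ)`; hence the 2. -/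
lemma softProd_le_exp_mul (ε : Fin d → ℝ) {g g' : (h : Fin d) → Fin (k h + 1) → ℝ} {τ : ℝ}
    (hg : ∀ h j, |g h j - g' h j| ≤ τ) :
    softProd ε g ≤ Real.exp (2 * τ * ∑ h, |ε h|) * softProd ε g' := by
  have key : ∀ (h : Fin d) (j : Fin (k h + 1)), |ε h * g h j - ε h * g' h j| ≤ |ε h| * τ :=
    fun h j => by
      rw [← mul_sub, abs_mul]
      exact mul_le_mul_of_nonneg_left (hg h j) (abs_nonneg _)
  rw [Finset.mul_sum, Real.exp_sum, softProd, softProd, ← Finset.prod_mul_distrib]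
  refine Finset.prod_le_prod (fun h _ => (softProd_factor_pos ε g h).le) fun h _ => ?_
  have h1 : Real.exp (ε h * g h 0) ≤ Real.exp (|ε h| * τ) * Real.exp (ε h * g' h 0) := by
    rw [← Real.exp_add, Real.exp_le_exp]
    linarith [(abs_le.1 (key h 0)).2]
  have h2 : ∑ j, Real.exp (ε h * g' h j) ≤
      Real.exp (|ε h| * τ) * ∑ j, Real.exp (ε h * g h j) := by
    rw [Finset.mul_sum]
    refine Finset.sum_le_sum fun j _ => ?_
    rw [← Real.exp_add, Real.exp_le_exp]
    linarith [(abs_le.1 (key h j)).1]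
  rw [div_le_iff₀ (by positivity)]
  have h3 : Real.exp (2 * τ * |ε h|) = Real.exp (|ε h| * τ) * Real.exp (|ε h| * τ) := by
    rw [← Real.exp_add]; congr 1; ring
  have hpos : 0 < ∑ j, Real.exp (ε h * g' h j) := by positivity
  rw [h3, mul_assoc (Real.exp _), div_eq_mul_inv]
  calc Real.exp (ε h * g h 0) ≤ Real.exp (|ε h| * τ) * Real.exp (ε h * g' h 0) := h1
    _ = (Real.exp (|ε h| * τ) * Real.exp (ε h * g' h 0) * (∑ j, Real.exp (ε h * g' h j))⁻¹) *
          ∑ j, Real.exp (ε h * g' h j) := by field_simp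
    _ ≤ (Real.exp (|ε h| * τ) * Real.exp (ε h * g' h 0) * (∑ j, Real.exp (ε h * g' h j))⁻¹) *
          (Real.exp (|ε h| * τ) * ∑ j, Real.exp (ε h * g h j)) := by gcongr
    _ = _ := by ring

/-- The multiplicative comparison, used in both directions, becomes additive because the products
are at most 1. -/
lemma abs_softProd_sub_le (ε : Fin d → ℝ) {g g' : (h : Fin d) → Fin (k h + 1) → ℝ} {τ : ℝ}
    (hτ : 0 ≤ τ) (hg : ∀ h j, |g h j - g' h j| ≤ τ) :
    |softProd ε g - softProd ε g'| ≤ Real.exp (2 * τ * ∑ h, |ε h|) - 1 := by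
  have h1 := softProd_le_exp_mul ε hg
  have h2 := softProd_le_exp_mul ε (g := g') (g' := g) (τ := τ)
    fun h j => by rw [abs_sub_comm]; exact hg h j
  have he : 1 ≤ Real.exp (2 * τ * ∑ h, |ε h|) := by
    rw [Real.one_le_exp_iff]; positivity
  have := softProd_le_one ε g
  have := softProd_le_one ε g'
  rw [abs_sub_le_iff]
  constructor <;> nlinarith

/-- Comparison with zero utilities, for which each candidate is chosen uniformly; the bound depends
on `g` only through `C`. -/
lemma le_softProd (ε : Fin d → ℝ) {g : (h : Fin d) → Fin (k h + 1) → ℝ} {C : ℝ}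
    (hg : ∀ h j, |g h j| ≤ C) :
    (Real.exp (2 * C * ∑ h, |ε h|))⁻¹ * softProd (k := k) ε (fun _ _ => 0) ≤ softProd ε g := by
  rw [inv_mul_le_iff₀ (Real.exp_pos _)]
  exact softProd_le_exp_mul ε fun h j => by simpa using hg h j

end Softmax

/-! ### Slutsky's theorem on varying probability spaces -/

section Slutsky

variable {Ω : ℕ → Type*} [∀ n, MeasurableSpace (Ω n)] {Q : ∀ n, Measure (Ω n)}
  [∀ n, IsProbabilityMeasure (Q n)]

lemma charFun_map_real {α : Type*} [MeasurableSpace α] {μ : Measure α} {U : α → ℝ}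
    (hU : AEMeasurable U μ) (t : ℝ) :
    charFun (μ.map U) t = ∫ ω, Complex.exp ((t * U ω : ℝ) * Complex.I) ∂μ := by
  rw [charFun_apply_real, integral_map hU (by fun_prop)]
  simp

lemma norm_exp_mul_I_sub_le (x y : ℝ) :
    ‖Complex.exp (x * Complex.I) - Complex.exp (y * Complex.I)‖ ≤ |x - y| := by
  have h : Complex.exp (x * Complex.I) - Complex.exp (y * Complex.I) =
      Complex.exp (y * Complex.I) * (Complex.exp (Complex.I * (x - y : ℝ)) - 1) := by
    rw [mul_sub, ← Complex.exp_add]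
    congr 2 <;> push_cast <;> ring
  rw [h, norm_mul, Complex.norm_exp_ofReal_mul_I, one_mul]
  exact Real.norm_exp_I_mul_ofReal_sub_one_le

/-- Where `|V - U| ≤ δ`, the map `x ↦ exp (i t x)` is `|t|`-Lipschitz; elsewhere two points of the
unit circle are at distance at most 2. -/
lemma norm_charFun_map_sub_le {α : Type*} [MeasurableSpace α] {μ : Measure α}
    [IsProbabilityMeasure μ] {U V : α → ℝ} (hU : AEMeasurable U μ) (hV : AEMeasurable V μ)
    (t : ℝ) {δ : ℝ} (hδ : 0 ≤ δ) :
    ‖charFun (μ.map V) t - charFun (μ.map U) t‖ ≤ |t| * δ + 2 * μ.real {ω | δ < |V ω - U ω|} := by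
  set A := {ω | δ < |V ω - U ω|}
  have hA : NullMeasurableSet A μ := nullMeasurableSet_lt aemeasurable_const
    (by fun_prop)
  have hint : ∀ W : α → ℝ, AEMeasurable W μ →
      Integrable (fun ω => Complex.exp ((t * W ω : ℝ) * Complex.I)) μ := fun W hW =>
    Integrable.of_bound (C := 1) (by fun_prop)
      (ae_of_all _ fun ω => (Complex.norm_exp_ofReal_mul_I _).le)
  rw [charFun_map_real hU, charFun_map_real hV, ← integral_sub (hint V hV) (hint U hU)]
  refine (norm_integral_le_integral_norm _).trans ?_
  calc ∫ ω, ‖Complex.exp ((t * V ω : ℝ) * Complex.I) - Complex.exp ((t * U ω : ℝ) * Complex.I)‖ ∂μ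
      ≤ ∫ ω, (|t| * δ + A.indicator (fun _ => 2) ω) ∂μ := by
        refine integral_mono ((hint V hV).sub (hint U hU)).norm
          ((integrable_const _).add ((integrable_const 2).indicator₀ hA)) fun ω => ?_
        by_cases hω : ω ∈ A
        · simp only [hω, Set.indicator_of_mem]
          have : ‖Complex.exp ((t * V ω : ℝ) * Complex.I) -
              Complex.exp ((t * U ω : ℝ) * Complex.I)‖ ≤ 2 := by
            refine (norm_sub_le _ _).trans ?_
            rw [Complex.norm_exp_ofReal_mul_I, Complex.norm_exp_ofReal_mul_I]; norm_num
          nlinarith [mul_nonneg (abs_nonneg t) hδ]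
        · simp only [hω, not_false_eq_true, Set.indicator_of_notMem, add_zero]
          refine (norm_exp_mul_I_sub_le _ _).trans ?_
          rw [← mul_sub, abs_mul]
          exact mul_le_mul_of_nonneg_left (not_lt.1 hω) (abs_nonneg t)
    _ = _ := by
        rw [integral_add (integrable_const _) ((integrable_const 2).indicator₀ hA),
          integral_indicator₀ hA]
        simp [mul_comm]

/-- Convergence in distribution is stable under perturbations that vanish in probability. -/
lemma tendstoInDistribution_of_sub_tendsto_zero {Ω' : Type*} [MeasurableSpace Ω']
    {μ' : Measure Ω'} [IsProbabilityMeasure μ'] {U V : ∀ n, Ω n → ℝ} {Z : Ω' → ℝ}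
    (hU : TendstoInDistribution U atTop Z Q μ') (hV : ∀ n, AEMeasurable (V n) (Q n))
    (hUV : ∀ δ : ℝ, 0 < δ → Tendsto (fun n => (Q n).real {ω | δ < |V n ω - U n ω|}) atTop (𝓝 0)) :
    TendstoInDistribution V atTop Z Q μ' where
  forall_aemeasurable := hV
  aemeasurable_limit := hU.aemeasurable_limit
  tendsto := by
    refine ProbabilityMeasure.tendsto_iff_tendsto_charFun.2 fun t => ?_
    have h := ProbabilityMeasure.tendsto_iff_tendsto_charFun.1 hU.tendsto t
    refine Tendsto.congr_dist h ?_
    simp only [ProbabilityMeasure.coe_mk, dist_comm (charFun ((Q _).map (U _)) t), dist_eq_norm]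
    rw [Metric.tendsto_atTop']
    intro η hη
    -- This makes `|t| δ < η / 2` even when `t = 0`; the other half of `η` is twice the probability
    -- bound `η / 4`.
    set δ := η / (2 * (|t| + 1)) with hδ
    have hδ0 : 0 < δ := by positivity
    have hev := (hUV δ hδ0).eventually (gt_mem_nhds (show (0 : ℝ) < η / 4 by positivity))
    obtain ⟨N, hN⟩ := eventually_atTop.1 hev
    refine ⟨N, fun n hn => ?_⟩
    have h1 := norm_charFun_map_sub_le (hU.forall_aemeasurable n) (hV n) t hδ0.le
    have h2 := hN n hn.le
    have h3 : |t| * δ < η / 2 := by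
      rw [hδ, mul_div_assoc', div_lt_div_iff₀ (by positivity) (by positivity)]
      nlinarith [abs_nonneg t]
    simp only [dist_zero_right, norm_norm]
    linarith

end Slutsky

/-! ### The characteristic function of a standardized binomial variable -/

lemma norm_pow_sub_pow_le_mul {z w : ℂ} (hz : ‖z‖ ≤ 1) (hw : ‖w‖ ≤ 1) (N : ℕ) :
    ‖z ^ N - w ^ N‖ ≤ N * ‖z - w‖ := by
  induction N with
  | zero => simp
  | succ N ih =>
    have : z ^ (N + 1) - w ^ (N + 1) = z * (z ^ N - w ^ N) + (z - w) * w ^ N := by ring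
    rw [this]
    refine (norm_add_le _ _).trans ?_
    rw [norm_mul, norm_mul, norm_pow]
    have h1 : ‖w‖ ^ N ≤ 1 := pow_le_one₀ (norm_nonneg _) hw
    have h2 : ‖z‖ * ‖z ^ N - w ^ N‖ ≤ 1 * (N * ‖z - w‖) :=
      mul_le_mul hz ih (norm_nonneg _) zero_le_one
    have h3 : ‖z - w‖ * ‖w‖ ^ N ≤ ‖z - w‖ := mul_le_of_le_one_right (norm_nonneg _) h1
    push_cast
    linarith

/-- The characteristic function at `s` of a centred Bernoulli variable with parameter `p`. -/
def bernoulliChar (p s : ℝ) : ℂ :=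
  p * Complex.exp ((s * (1 - p) : ℝ) * Complex.I) +
    (1 - p : ℝ) * Complex.exp ((s * (0 - p) : ℝ) * Complex.I)

lemma norm_exp_mul_I_taylor_le {x : ℝ} (hx : |x| ≤ 1) :
    ‖Complex.exp (x * Complex.I) - (1 + x * Complex.I - (x ^ 2 / 2 : ℝ))‖ ≤ |x| ^ 3 := by
  have hn : ‖(x : ℂ) * Complex.I‖ = |x| := by simp
  have := Complex.exp_bound' (x := x * Complex.I) (n := 3) (by
    rw [hn]; norm_num; linarith)
  rw [hn] at this
  have hs : ∑ m ∈ Finset.range 3, ((x : ℂ) * Complex.I) ^ m / (m.factorial : ℂ) =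
      1 + x * Complex.I - (x ^ 2 / 2 : ℝ) := by
    simp [Finset.sum_range_succ, mul_pow]
    ring
  rw [hs] at this
  refine this.trans ?_
  have h3 : 0 ≤ |x| ^ 3 := by positivity
  norm_num [Nat.factorial]
  linarith

/-- Taylor expansion of both exponentials: centring cancels the linear terms, and the quadratic ones
add up to the variance `p (1 - p)`. -/
lemma norm_bernoulliChar_sub_le {p s : ℝ} (hp0 : 0 ≤ p) (hp1 : p ≤ 1) (hs : |s| ≤ 1) :
    ‖bernoulliChar p s - (1 - (s ^ 2 * (p * (1 - p)) / 2 : ℝ))‖ ≤ |s| ^ 3 := by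
  have ha : ∀ c : ℝ, |c| ≤ 1 → |s * c| ≤ |s| := fun c hc => by
    rw [abs_mul]; exact mul_le_of_le_one_right (abs_nonneg _) hc
  have h1 : |1 - p| ≤ 1 := abs_le.2 ⟨by linarith, by linarith⟩
  have h2 : |0 - p| ≤ 1 := abs_le.2 ⟨by linarith, by linarith⟩
  have e1 := (norm_exp_mul_I_taylor_le ((ha _ h1).trans hs)).trans
    (pow_le_pow_left₀ (abs_nonneg _) (ha _ h1) 3)
  have e2 := (norm_exp_mul_I_taylor_le ((ha _ h2).trans hs)).trans
    (pow_le_pow_left₀ (abs_nonneg _) (ha _ h2) 3)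
  have key : bernoulliChar p s - (1 - (s ^ 2 * (p * (1 - p)) / 2 : ℝ)) =
      p * (Complex.exp ((s * (1 - p) : ℝ) * Complex.I) -
        (1 + (s * (1 - p) : ℝ) * Complex.I - ((s * (1 - p)) ^ 2 / 2 : ℝ))) +
      (1 - p : ℝ) * (Complex.exp ((s * (0 - p) : ℝ) * Complex.I) -
        (1 + (s * (0 - p) : ℝ) * Complex.I - ((s * (0 - p)) ^ 2 / 2 : ℝ))) := by
    rw [bernoulliChar]
    push_cast
    ring
  rw [key]
  refine (norm_add_le _ _).trans ?_
  rw [norm_mul, norm_mul, Complex.norm_real, Complex.norm_real, Real.norm_of_nonneg hp0,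
    Real.norm_of_nonneg (sub_nonneg.2 hp1)]
  nlinarith [mul_le_mul_of_nonneg_left e1 hp0, mul_le_mul_of_nonneg_left e2 (sub_nonneg.2 hp1)]

lemma norm_bernoulliChar_le_one {p : ℝ} (hp0 : 0 ≤ p) (hp1 : p ≤ 1) (s : ℝ) :
    ‖bernoulliChar p s‖ ≤ 1 := by
  refine (norm_add_le _ _).trans ?_
  rw [norm_mul, norm_mul, Complex.norm_exp_ofReal_mul_I, Complex.norm_exp_ofReal_mul_I,
    Complex.norm_real, Complex.norm_real, Real.norm_of_nonneg hp0,
    Real.norm_of_nonneg (sub_nonneg.2 hp1)]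
  linarith

/-- A quantitative central limit theorem, needed because `p` varies with the sample size: the error
depends on `p` only through the lower bound `v` of its variance. The limit is written as the `N`-th
power of `exp (-t² / (2N))`, so that it suffices to compare the bases and multiply by `N`. -/
lemma norm_bernoulliChar_pow_sub_le {p v t : ℝ} {N : ℕ} (hp0 : 0 ≤ p) (hp1 : p ≤ 1)
    (hv : 0 < v) (hpv : v ≤ p * (1 - p)) (hN : 0 < N) (ht : |t| / (√N * √v) ≤ 1)
    (ht' : t ^ 2 / (2 * N) ≤ 1) :
    ‖bernoulliChar p (t / (√N * √(p * (1 - p)))) ^ N - Complex.exp (-t ^ 2 / 2)‖ ≤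
      |t| ^ 3 / √v ^ 3 / √N + t ^ 4 / 4 / N := by
  have hN' : (0 : ℝ) < N := by exact_mod_cast hN
  have hNs : 0 < √(N : ℝ) := Real.sqrt_pos.2 hN'
  have hvs : 0 < √v := Real.sqrt_pos.2 hv
  have hq : 0 < p * (1 - p) := hv.trans_le hpv
  have hqs : 0 < √(p * (1 - p)) := Real.sqrt_pos.2 hq
  have hvq : √v ≤ √(p * (1 - p)) := Real.sqrt_le_sqrt hpv
  set s := t / (√N * √(p * (1 - p))) with hs_def
  have hs : |s| ≤ |t| / (√N * √v) := by
    rw [hs_def, abs_div, abs_of_pos (by positivity : 0 < √(N : ℝ) * √(p * (1 - p)))]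
    gcongr
  have hs2 : s ^ 2 * (p * (1 - p)) / 2 = t ^ 2 / (2 * N) := by
    rw [hs_def, div_pow, mul_pow, Real.sq_sqrt hN'.le, Real.sq_sqrt hq.le]
    have h1 := left_ne_zero_of_mul hq.ne'
    have h2 := right_ne_zero_of_mul hq.ne'
    field_simp
  have hexp : Complex.exp (-t ^ 2 / 2) = Complex.exp ((-(t ^ 2 / (2 * N)) : ℝ)) ^ N := by
    rw [← Complex.exp_nat_mul]
    congr 1
    have : (N : ℂ) ≠ 0 := by exact_mod_cast hN.ne'
    push_cast
    field_simp
  have hw : ‖Complex.exp ((-(t ^ 2 / (2 * N)) : ℝ))‖ ≤ 1 := by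
    rw [Complex.norm_exp_ofReal, Real.exp_le_one_iff]
    have : 0 ≤ t ^ 2 / (2 * N) := by positivity
    linarith
  have h1 := norm_bernoulliChar_sub_le hp0 hp1 (hs.trans ht)
  have h2 : ‖Complex.exp ((-(t ^ 2 / (2 * N)) : ℝ)) - 1 - ((-(t ^ 2 / (2 * N)) : ℝ) : ℂ)‖ ≤
      (t ^ 2 / (2 * N)) ^ 2 := by
    have h0 : ‖((-(t ^ 2 / (2 * N)) : ℝ) : ℂ)‖ = t ^ 2 / (2 * N) := by
      rw [Complex.norm_real, norm_neg, Real.norm_of_nonneg (by positivity)]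
    have := Complex.norm_exp_sub_one_sub_id_le (x := ((-(t ^ 2 / (2 * N)) : ℝ) : ℂ)) (by rwa [h0])
    rwa [h0] at this
  rw [hs2] at h1
  have h3 : ‖bernoulliChar p s - Complex.exp ((-(t ^ 2 / (2 * N)) : ℝ))‖ ≤
      |s| ^ 3 + (t ^ 2 / (2 * N)) ^ 2 := by
    have : bernoulliChar p s - Complex.exp ((-(t ^ 2 / (2 * N)) : ℝ)) =
        (bernoulliChar p s - (1 - (t ^ 2 / (2 * N) : ℝ))) -
        (Complex.exp ((-(t ^ 2 / (2 * N)) : ℝ)) - 1 - ((-(t ^ 2 / (2 * N)) : ℝ) : ℂ)) := by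
      push_cast; ring
    rw [this]
    exact (norm_sub_le _ _).trans (add_le_add h1 h2)
  rw [hexp]
  refine (norm_pow_sub_pow_le_mul (norm_bernoulliChar_le_one hp0 hp1 s) hw N).trans ?_
  calc (N : ℝ) * ‖bernoulliChar p s - Complex.exp ((-(t ^ 2 / (2 * N)) : ℝ))‖
      ≤ N * ((|t| / (√N * √v)) ^ 3 + (t ^ 2 / (2 * N)) ^ 2) := by
        refine mul_le_mul_of_nonneg_left (h3.trans ?_) hN'.le
        gcongr
    _ = _ := by
        have : (N : ℝ) = √N ^ 2 := (Real.sq_sqrt hN'.le).symm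
        rw [mul_add]
        congr 1
        · nth_rw 1 [this]
          field_simp
        · field_simp
          ring

lemma tendsto_bernoulliChar_pow {N : ℕ → ℕ} {p : ℕ → ℝ} {v : ℝ} (hN : Tendsto N atTop atTop)
    (hp : ∀ᶠ n in atTop, 0 ≤ p n ∧ p n ≤ 1 ∧ v ≤ p n * (1 - p n)) (hv : 0 < v) (t : ℝ) :
    Tendsto (fun n => bernoulliChar (p n) (t / (√(N n) * √(p n * (1 - p n)))) ^ N n) atTop
      (𝓝 (Complex.exp (-t ^ 2 / 2))) := by
  have hNr : Tendsto (fun n => (N n : ℝ)) atTop atTop := tendsto_natCast_atTop_atTop.comp hN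
  have hNs : Tendsto (fun n => √(N n : ℝ)) atTop atTop := Real.tendsto_sqrt_atTop.comp hNr
  rw [tendsto_iff_norm_sub_tendsto_zero]
  have hlim : Tendsto (fun n => |t| ^ 3 / √v ^ 3 / √(N n : ℝ) + t ^ 4 / 4 / (N n : ℝ)) atTop
      (𝓝 0) := by
    simpa using (hNs.const_div_atTop (|t| ^ 3 / √v ^ 3)).add (hNr.const_div_atTop (t ^ 4 / 4))
  have h1 : Tendsto (fun n => |t| / (√(N n : ℝ) * √v)) atTop (𝓝 0) :=
    (hNs.atTop_mul_const (Real.sqrt_pos.2 hv)).const_div_atTop _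
  have h2 : Tendsto (fun n => t ^ 2 / (2 * (N n : ℝ))) atTop (𝓝 0) :=
    (hNr.const_mul_atTop (by norm_num)).const_div_atTop _
  refine squeeze_zero' (Eventually.of_forall fun n => norm_nonneg _) ?_ hlim
  filter_upwards [hp, hN.eventually_gt_atTop 0, h1.eventually (gt_mem_nhds one_pos),
    h2.eventually (gt_mem_nhds one_pos)] with n h3 h4 h5 h6
  exact norm_bernoulliChar_pow_sub_le h3.1 h3.2.1 hv h3.2.2 h4 h5.le h6.le

/-! ### Counts and proportions -/

section Sample

variable {𝒳 : Type*} {n : ℕ}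

lemma count_mono (x : Fin n → 𝒳) {R R' : Set 𝒳} (h : R ⊆ R') : count x R ≤ count x R' :=
  Finset.card_le_card fun i hi => by
    simp only [Finset.mem_filter, Finset.mem_univ, true_and] at hi ⊢
    exact h hi

open Classical in
lemma sum_ite_mem (x : Fin n → 𝒳) (R : Set 𝒳) :
    ∑ i, (if x i ∈ R then (1 : ℝ) else 0) = count x R := by
  simp [count, Finset.sum_boole]

lemma count_diff (x : Fin n → 𝒳) {P C : Set 𝒳} (h : C ⊆ P) :
    (count x (P \ C) : ℝ) = count x P - count x C := by
  classical
  rw [← sum_ite_mem, ← sum_ite_mem, ← sum_ite_mem, ← Finset.sum_sub_distrib]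
  refine Finset.sum_congr rfl fun i _ => ?_
  by_cases hC : x i ∈ C
  · simp [hC, h hC]
  · simp [hC]

open Classical in
/-- The average of `f` over the observations in the region `R`. -/
def avg (x : Fin n → 𝒳) (f : Fin n → ℝ) (R : Set 𝒳) : ℝ :=
  (1 / (count x R : ℝ)) * ∑ i, f i * (if x i ∈ R then 1 else 0)

lemma prop_eq_avg (x : Fin n → 𝒳) (y : Fin n → Bool) (R : Set 𝒳) :
    prop x y R = avg x (fun i => ((y i).toNat : ℝ)) R := rfl

open Classical in
lemma count_mul_avg (x : Fin n → 𝒳) (f : Fin n → ℝ) {R : Set 𝒳} (hR : 0 < count x R) :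
    (count x R : ℝ) * avg x f R = ∑ i, f i * (if x i ∈ R then 1 else 0) := by
  have : (count x R : ℝ) ≠ 0 := by exact_mod_cast hR.ne'
  rw [avg]; field_simp

lemma avg_mem_Icc (x : Fin n → 𝒳) {f : Fin n → ℝ} {a b : ℝ} (hf : ∀ i, f i ∈ Set.Icc a b)
    {R : Set 𝒳} (hR : 0 < count x R) : avg x f R ∈ Set.Icc a b := by
  classical
  have h0 : (0 : ℝ) < count x R := by exact_mod_cast hR
  have h := count_mul_avg x f hR
  have h1 : a * count x R ≤ ∑ i, f i * (if x i ∈ R then 1 else 0) := by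
    rw [← sum_ite_mem, Finset.mul_sum]
    exact Finset.sum_le_sum fun i _ => mul_le_mul_of_nonneg_right (hf i).1 (by positivity)
  have h2 : ∑ i, f i * (if x i ∈ R then 1 else 0) ≤ b * count x R := by
    rw [← sum_ite_mem, Finset.mul_sum]
    exact Finset.sum_le_sum fun i _ => mul_le_mul_of_nonneg_right (hf i).2 (by positivity)
  constructor <;> nlinarith

/-- No count has to be positive: on an empty region the average is 0, as `1 / 0 = 0`. -/
lemma avg_mem_unit (x : Fin n → 𝒳) {f : Fin n → ℝ} (hf : ∀ i, f i ∈ Set.Icc (0 : ℝ) 1)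
    (R : Set 𝒳) : avg x f R ∈ Set.Icc (0 : ℝ) 1 := by
  rcases (count x R).eq_zero_or_pos with h | h
  · simp [avg, h]
  · exact avg_mem_Icc x hf h

lemma prop_mem_unit (x : Fin n → 𝒳) (y : Fin n → Bool) (R : Set 𝒳) :
    prop x y R ∈ Set.Icc (0 : ℝ) 1 :=
  avg_mem_unit x (fun i => by cases y i <;> simp) R

lemma count_mul_prop_diff (x : Fin n → 𝒳) (y : Fin n → Bool) {P C : Set 𝒳} (h : C ⊆ P)
    (hC : 0 < count x C) (hD : 0 < count x (P \ C)) :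
    (count x (P \ C) : ℝ) * prop x y (P \ C) =
      count x P * prop x y P - count x C * prop x y C := by
  classical
  have hP : 0 < count x P := hC.trans_le (count_mono x h)
  rw [prop_eq_avg, prop_eq_avg, prop_eq_avg, count_mul_avg x _ hP, count_mul_avg x _ hC,
    count_mul_avg x _ hD, ← Finset.sum_sub_distrib]
  refine Finset.sum_congr rfl fun i _ => ?_
  by_cases hC : x i ∈ C
  · simp [hC, h hC]
  · simp [hC]

/-- The information gain as a function of the proportions `r` of the regions. -/
def gainAt (I : ℝ → ℝ) (x : Fin n → 𝒳) (r : Set 𝒳 → ℝ) (P C : Set 𝒳) : ℝ :=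
  I (r P) - ((count x C : ℝ) / count x P * I (r C) +
    (count x (P \ C) : ℝ) / count x P * I (r (P \ C)))

/-- Only an inequality, since both weights are 0 when `P` contains no observation. It suffices for
the bounds on gains, which therefore hold for every sample. -/
lemma weights_add_le_one (x : Fin n → 𝒳) {P C : Set 𝒳} (h : C ⊆ P) :
    (count x C : ℝ) / count x P + (count x (P \ C) : ℝ) / count x P ≤ 1 := by
  rw [← add_div, count_diff x h, add_sub_cancel]
  exact div_self_le_one _

lemma abs_gainAt_le {I : ℝ → ℝ} {B : ℝ} (hI : ∀ p ∈ Set.Icc (0 : ℝ) 1, |I p| ≤ B)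
    (x : Fin n → 𝒳) {r : Set 𝒳 → ℝ} (hr : ∀ R, r R ∈ Set.Icc (0 : ℝ) 1) {P C : Set 𝒳}
    (h : C ⊆ P) : |gainAt I x r P C| ≤ 2 * B := by
  have hw := weights_add_le_one x h
  have hB : 0 ≤ B := (abs_nonneg _).trans (hI _ (hr P))
  have h1 : 0 ≤ (count x C : ℝ) / count x P := by positivity
  have h2 : 0 ≤ (count x (P \ C) : ℝ) / count x P := by positivity
  have a1 := abs_le.1 (hI _ (hr P))
  have a2 := abs_le.1 (hI _ (hr C))
  have a3 := abs_le.1 (hI _ (hr (P \ C)))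
  rw [gainAt, abs_le]
  constructor <;> nlinarith

lemma abs_gainAt_sub_le {I : ℝ → ℝ} {τ : ℝ} (x : Fin n → 𝒳) {r r' : Set 𝒳 → ℝ} {P C : Set 𝒳}
    (h : C ⊆ P) (hP : |I (r P) - I (r' P)| ≤ τ) (hC : |I (r C) - I (r' C)| ≤ τ)
    (hD : |I (r (P \ C)) - I (r' (P \ C))| ≤ τ) :
    |gainAt I x r P C - gainAt I x r' P C| ≤ 2 * τ := by
  have hw := weights_add_le_one x h
  have hB : 0 ≤ τ := (abs_nonneg _).trans hP
  have h1 : 0 ≤ (count x C : ℝ) / count x P := by positivity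
  have h2 : 0 ≤ (count x (P \ C) : ℝ) / count x P := by positivity
  have a1 := abs_le.1 hP
  have a2 := abs_le.1 hC
  have a3 := abs_le.1 hD
  rw [gainAt, gainAt, abs_le]
  constructor <;> nlinarith

/-! ### Moving the first key statistic with the orthogonalized proportions fixed -/

/-- The proportion of the region `R`, when the first key statistic is moved to the value `u` and
the orthogonalized proportions are kept fixed. -/
def shifted (x : Fin n → 𝒳) (y : Fin n → Bool) (l : Set 𝒳) (u : ℝ) (R : Set 𝒳) : ℝ :=
  prop x y R + (count x (R ∩ l) : ℝ) / (count x R * √(count x l)) *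
    (u - √(count x l) * prop x y l)

/-- The slope in `u` is `n_{R ∩ l} / (n_R √n_l) ≤ 1 / √n_l`. This is what flattens the correction
factor: a bounded move of the first key statistic hardly moves any proportion. -/
lemma abs_shifted_sub_le (x : Fin n → 𝒳) (y : Fin n → Bool) (l : Set 𝒳) (u : ℝ) (R : Set 𝒳) :
    |shifted x y l u R - prop x y R| ≤ |u - √(count x l) * prop x y l| / √(count x l) := by
  have hc : (count x (R ∩ l) : ℝ) / count x R ≤ 1 := by
    refine div_le_one_of_le₀ ?_ (Nat.cast_nonneg _)
    exact_mod_cast count_mono x Set.inter_subset_left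
  have h0 : 0 ≤ (count x (R ∩ l) : ℝ) / count x R := by positivity
  rw [shifted, add_sub_cancel_left, ← div_div, abs_mul, abs_div, abs_of_nonneg h0,
    abs_of_nonneg (Real.sqrt_nonneg _), div_mul_eq_mul_div]
  gcongr
  exact mul_le_of_le_one_left (abs_nonneg _) hc

lemma orthProp_self (x : Fin n → 𝒳) (y : Fin n → Bool) (l : Set 𝒳) : orthProp x y l l = 0 := by
  rw [orthProp, Set.inter_self, Real.sqrt_mul_self (Nat.cast_nonneg _)]
  rcases eq_or_ne (count x l : ℝ) 0 with h | h
  · simp [h]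
  · rw [div_self h]; ring

lemma sqrt_mul_orthProp (x : Fin n → 𝒳) (y : Fin n → Bool) {l R : Set 𝒳} (hl : 0 < count x l)
    (hR : 0 < count x R) :
    √(count x R) * orthProp x y l R =
      count x R * prop x y R - count x (R ∩ l) / √(count x l) * (√(count x l) * prop x y l) := by
  have hl' : 0 < √(count x l : ℝ) := Real.sqrt_pos.2 (by exact_mod_cast hl)
  have hR' : 0 < √(count x R : ℝ) := Real.sqrt_pos.2 (by exact_mod_cast hR)
  rw [orthProp, Real.sqrt_mul (Nat.cast_nonneg _), mul_sub, ← mul_assoc,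
    Real.mul_self_sqrt (Nat.cast_nonneg _)]
  congr 1
  field_simp

lemma shifted_eq (x : Fin n → 𝒳) (y : Fin n → Bool) {l R : Set 𝒳} (hl : 0 < count x l)
    (hR : 0 < count x R) (u : ℝ) :
    (count x (R ∩ l) : ℝ) / (count x R * √(count x l)) * u +
      1 / √(count x R) * orthProp x y l R = shifted x y l u R := by
  have hR' : 0 < √(count x R : ℝ) := Real.sqrt_pos.2 (by exact_mod_cast hR)
  have hR0 : (0 : ℝ) < count x R := by exact_mod_cast hR
  have hl' : 0 < √(count x l : ℝ) := Real.sqrt_pos.2 (by exact_mod_cast hl)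
  have h : 1 / √(count x R) * orthProp x y l R =
      (√(count x R) * orthProp x y l R) / count x R := by
    nth_rw 3 [← Real.sq_sqrt hR0.le]
    field_simp
  rw [h, sqrt_mul_orthProp x y hl hR, shifted]
  field_simp
  ring

/-- Identifies the three linear forms in the key statistics with shifted proportions. The form of `P
\ C` comes from additivity: counts, and sums of outcomes, over `P \ C` are those over `P` minus
those over `C`. -/
lemma scaledGain_scaling_args (x : Fin n → 𝒳) (y : Fin n → Bool) {l P C : Set 𝒳} (hCP : C ⊆ P)
    (hlP : l ⊆ P) (hl : 0 < count x l) (hC : 0 < count x C) (hD : 0 < count x (P \ C)) (u : ℝ) :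
    scaling x l P C 0 * u + scaling x l P C 1 * orthProp x y l P = shifted x y l u P ∧
    scaling x l P C 2 * u + scaling x l P C 3 * orthProp x y l C = shifted x y l u C ∧
    scaling x l P C 4 * u + scaling x l P C 5 * orthProp x y l P +
      scaling x l P C 6 * orthProp x y l C = shifted x y l u (P \ C) := by
  have hP : 0 < count x P := hC.trans_le (count_mono x hCP)
  have hl0 : (0 : ℝ) < count x l := by exact_mod_cast hl
  have hl' : 0 < √(count x l : ℝ) := Real.sqrt_pos.2 hl0
  have hP0 : (0 : ℝ) < count x P := by exact_mod_cast hP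
  refine ⟨?_, ?_, ?_⟩
  · rw [← shifted_eq x y hl hP, Set.inter_eq_right.2 hlP]
    simp only [scaling, Matrix.cons_val]
    congr 2
    nth_rw 2 [← Real.sq_sqrt hl0.le]
    field_simp
  · rw [← shifted_eq x y hl hC]
    simp [scaling]
  · have hd := count_diff x hCP
    have hD0 : (0 : ℝ) < count x (P \ C) := by exact_mod_cast hD
    have hdl : (count x (P \ C ∩ l) : ℝ) = count x (P ∩ l) - count x (C ∩ l) := by
      rw [← count_diff x (Set.inter_subset_inter_left l hCP), Set.inter_sdiff_distrib_right]
    have h1 := sqrt_mul_orthProp x y hl hP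
    have h2 := sqrt_mul_orthProp x y hl hC
    have h3 := count_mul_prop_diff x y hCP hC hD
    simp only [scaling, Matrix.cons_val]
    rw [← hd, ← hdl]
    have h4 : √(count x P) / (count x (P \ C) : ℝ) * orthProp x y l P +
        -(√(count x C) / (count x (P \ C) : ℝ)) * orthProp x y l C =
        (√(count x P) * orthProp x y l P - √(count x C) * orthProp x y l C) / count x (P \ C) := by
      ring
    have h5 : √(count x P) * orthProp x y l P - √(count x C) * orthProp x y l C =
        count x (P \ C) * prop x y (P \ C) -
          count x (P \ C ∩ l) / √(count x l) * (√(count x l) * prop x y l) := by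
      rw [h1, h2, h3, hdl]; ring
    rw [add_assoc, h4, h5, shifted]
    field_simp
    ring

lemma scaledGain_scaling (I : ℝ → ℝ) (x : Fin n → 𝒳) (y : Fin n → Bool) {l P C : Set 𝒳}
    (hCP : C ⊆ P) (hlP : l ⊆ P) (hl : 0 < count x l) (hC : 0 < count x C)
    (hD : 0 < count x (P \ C)) (u : ℝ) :
    scaledGain I (scaling x l P C) (u, orthProp x y l P, orthProp x y l C) =
      gainAt I x (shifted x y l u) P C := by
  obtain ⟨h1, h2, h3⟩ := scaledGain_scaling_args x y hCP hlP hl hC hD u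
  have hP0 : (0 : ℝ) < count x P := by exact_mod_cast hC.trans_le (count_mono x hCP)
  simp only [scaledGain, h1, h2, h3, gainAt]
  have h7 : scaling x l P C 7 = (count x C : ℝ) / count x P := by simp [scaling]
  have h8 : 1 - (count x C : ℝ) / count x P = (count x (P \ C) : ℝ) / count x P := by
    rw [count_diff x hCP]; field_simp
  rw [h7, h8]
  ring

lemma mem_scaledDomain_scaling (x : Fin n → 𝒳) (y : Fin n → Bool) {l P C : Set 𝒳}
    (hCP : C ⊆ P) (hlP : l ⊆ P) (hl : 0 < count x l) (hC : 0 < count x C)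
    (hD : 0 < count x (P \ C)) (u : ℝ) :
    (u, orthProp x y l P, orthProp x y l C) ∈ scaledDomain (scaling x l P C) ↔
      shifted x y l u P ∈ Set.Ioo (0 : ℝ) 1 ∧ shifted x y l u C ∈ Set.Ioo (0 : ℝ) 1 ∧
        shifted x y l u (P \ C) ∈ Set.Ioo (0 : ℝ) 1 := by
  obtain ⟨h1, h2, h3⟩ := scaledGain_scaling_args x y hCP hlP hl hC hD u
  simp only [scaledDomain, Set.mem_ofPred_eq, h1, h2, h3]

end Sample

namespace TreeFit

variable {𝒳 : Type*} (t : TreeFit 𝒳) {n : ℕ}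

/-! ### The regions along the path -/

lemma leaf_subset_node (h : Fin (t.d + 1)) : t.leaf 0 ⊆ t.node h := by
  induction h using Fin.reverseInduction with
  | last => rw [t.node_last]
  | cast h ih =>
    rw [← t.cand_zero] at ih
    exact ih.trans (t.cand_subset h 0)

/-- The regions whose proportions enter the information gains along the path. -/
def regions : Set (Set 𝒳) :=
  {R | R = t.leaf 0 ∨ ∃ h j, R = t.node h.castSucc ∨ R = t.cand h j ∨
    R = t.node h.castSucc \ t.cand h j}

lemma leaf_mem_regions : t.leaf 0 ∈ t.regions := Or.inl rfl

lemma node_mem_regions (h : Fin t.d) : t.node h.castSucc ∈ t.regions :=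
  Or.inr ⟨h, 0, Or.inl rfl⟩

lemma cand_mem_regions (h : Fin t.d) (j : Fin (t.k h + 1)) : t.cand h j ∈ t.regions :=
  Or.inr ⟨h, j, Or.inr (Or.inl rfl)⟩

lemma diff_mem_regions (h : Fin t.d) (j : Fin (t.k h + 1)) :
    t.node h.castSucc \ t.cand h j ∈ t.regions :=
  Or.inr ⟨h, j, Or.inr (Or.inr rfl)⟩

lemma regions_finite : t.regions.Finite := by
  have : t.regions = {t.leaf 0} ∪ (Set.range (fun i : t.Idx => t.node i.1.castSucc) ∪
      (Set.range (fun i : t.Idx => t.cand i.1 i.2) ∪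
        Set.range (fun i : t.Idx => t.node i.1.castSucc \ t.cand i.1 i.2))) := by
    ext R
    simp only [regions, Set.mem_ofPred_eq, Set.mem_union, Set.mem_singleton_iff, Set.mem_range,
      Sigma.exists, exists_or, eq_comm]
  rw [this]
  exact (Set.finite_singleton _).union ((Set.finite_range _).union
    ((Set.finite_range _).union (Set.finite_range _)))

/-- Leaf and candidate regions grow because `n / n_R` is eventually at most `c + 1`; an internal
region of the path grows because it contains the leaf. -/
lemma tendsto_count {X : (n : ℕ) → Fin n → 𝒳} (hX : t.ProportionalGrowth X) {R : Set 𝒳}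
    (hR : R ∈ t.regions) : Tendsto (fun n => count (X n) R) atTop atTop := by
  have key : ∀ R : Set 𝒳,
      (R = t.leaf 0 ∨ ∃ h j, R = t.cand h j ∨ R = t.node h.castSucc \ t.cand h j) →
      Tendsto (fun n => count (X n) R) atTop atTop := by
    intro R hR
    obtain ⟨c, hc, hlim⟩ := hX R hR
    have hc' : c + 1 ≠ ∞ := by simp [hc.ne]
    have hev := hlim.eventually (ge_mem_nhds (ENNReal.lt_add_right hc.ne one_ne_zero))
    rw [← tendsto_natCast_atTop_iff (R := ℝ)]
    have hK : 0 < (c + 1).toReal := ENNReal.toReal_pos (by simp) hc'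
    refine tendsto_atTop_mono' _ ?_ ((tendsto_natCast_atTop_atTop (R := ℝ)).atTop_div_const hK)
    filter_upwards [hev, eventually_gt_atTop 0] with n hn hn0
    -- For `n > 0` an empty region would give `n / 0 = ∞`, which exceeds `c + 1`.
    have h0 : (count (X n) R : ℝ≥0∞) ≠ 0 := fun h0 => by
      rw [h0, ENNReal.div_zero (by exact_mod_cast hn0.ne')] at hn
      exact hc' (top_le_iff.1 hn)
    rw [ENNReal.div_le_iff h0 (ENNReal.natCast_ne_top _)] at hn
    have := ENNReal.toReal_mono (ENNReal.mul_ne_top hc' (ENNReal.natCast_ne_top _)) hn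
    rw [ENNReal.toReal_mul, ENNReal.toReal_natCast, ENNReal.toReal_natCast] at this
    rw [div_le_iff₀ hK]
    linarith
  rcases hR with rfl | ⟨h, j, rfl | hR⟩
  · exact key _ (Or.inl rfl)
  · exact tendsto_atTop_mono (fun n => count_mono (X n) (t.leaf_subset_node _))
      (key _ (Or.inl rfl))
  · exact key _ (Or.inr ⟨h, j, hR⟩)

/-! ### The correction factors at the observed statistics -/

lemma restStat_zero (x : Fin n → 𝒳) (y : Fin n → Bool) (h : Fin t.d) :
    t.restStat x y ⟨h, 0⟩ = orthProp x y (t.leaf 0) (t.node h.castSucc) := by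
  simp [restStat]

/-- The observed child is the next internal region, or the leaf itself at the end of the path; there
the default entry 0 is right, since the orthogonalized proportion of the leaf vanishes. -/
lemma childEntry_restStat (x : Fin n → 𝒳) (y : Fin n → Bool) (h : Fin t.d)
    (j : Fin (t.k h + 1)) :
    t.childEntry (t.restStat x y) h j = orthProp x y (t.leaf 0) (t.cand h j) := by
  unfold childEntry
  split_ifs with hj hd
  · subst hj
    rw [restStat_zero, t.cand_zero]
    rfl
  · subst hj
    have : h.succ = Fin.last t.d := by
      ext; have := h.2; simp; omega
    rw [t.cand_zero, this, t.node_last, orthProp_self]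
  · simp [restStat, hj]

variable {t} in
lemma gainFn_restStat (I : ℝ → ℝ) {x : Fin n → 𝒳} (hx : ∀ R ∈ t.regions, 0 < count x R)
    (y : Fin n → Bool) (h : Fin t.d) (j : Fin (t.k h + 1)) (u : ℝ) :
    t.gainFn I x h j u (t.restStat x y) =
      gainAt I x (shifted x y (t.leaf 0) u) (t.node h.castSucc) (t.cand h j) := by
  rw [gainFn, childEntry_restStat, restStat_zero, eta]
  exact scaledGain_scaling I x y (t.cand_subset h j) (t.leaf_subset_node _)
    (hx _ t.leaf_mem_regions) (hx _ (t.cand_mem_regions h j)) (hx _ (t.diff_mem_regions h j)) u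

variable {t} in
lemma mem_domain_restStat {x : Fin n → 𝒳} (hx : ∀ R ∈ t.regions, 0 < count x R)
    (y : Fin n → Bool) (u : ℝ)
    (hu : ∀ R ∈ t.regions, shifted x y (t.leaf 0) u R ∈ Set.Ioo (0 : ℝ) 1) :
    (u, t.restStat x y) ∈ t.domain x := by
  intro h j
  dsimp only
  rw [childEntry_restStat, restStat_zero, eta, mem_scaledDomain_scaling x y (t.cand_subset h j)
    (t.leaf_subset_node _) (hx _ t.leaf_mem_regions) (hx _ (t.cand_mem_regions h j))
    (hx _ (t.diff_mem_regions h j))]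
  exact ⟨hu _ (t.node_mem_regions h), hu _ (t.cand_mem_regions h j), hu _ (t.diff_mem_regions h j)⟩

/-- The probability of the observed splits as a function of the proportions `r` of the regions. -/
def selProb (I : ℝ → ℝ) (ε : Fin t.d → ℝ) (x : Fin n → 𝒳) (r : Set 𝒳 → ℝ) : ℝ :=
  softProd ε fun h j => gainAt I x r (t.node h.castSucc) (t.cand h j)

lemma prod_splitProb (I : ℝ → ℝ) (ε : Fin t.d → ℝ) (x : Fin n → 𝒳) (y : Fin n → Bool) :
    ∏ h, splitProb I (ε h) x y (t.node h.castSucc) (t.cand h) 0 =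
      t.selProb I ε x (prop x y) := rfl

variable {t} in
lemma prod_lam_restStat (I : ℝ → ℝ) (ε : Fin t.d → ℝ) {x : Fin n → 𝒳}
    (hx : ∀ R ∈ t.regions, 0 < count x R) (y : Fin n → Bool) (u : ℝ)
    (hu : ∀ R ∈ t.regions, shifted x y (t.leaf 0) u R ∈ Set.Ioo (0 : ℝ) 1) :
    ∏ h, t.lam I ε x h u (t.restStat x y) =
      t.selProb I ε x (shifted x y (t.leaf 0) u) := by
  refine Finset.prod_congr rfl fun h _ => ?_
  rw [lam, if_pos (mem_domain_restStat hx y u hu)]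
  simp only [gainFn_restStat I hx]

lemma lam_nonneg (I : ℝ → ℝ) (ε : Fin t.d → ℝ) (x : Fin n → 𝒳) (h : Fin t.d) (u : ℝ)
    (v : t.Idx → ℝ) : 0 ≤ t.lam I ε x h u v := by
  rw [lam]; split_ifs <;> positivity

lemma lam_le_one (I : ℝ → ℝ) (ε : Fin t.d → ℝ) (x : Fin n → 𝒳) (h : Fin t.d) (u : ℝ)
    (v : t.Idx → ℝ) : t.lam I ε x h u v ≤ 1 := by
  rw [lam]
  split_ifs
  · rw [div_le_one (by positivity)]
    exact Finset.single_le_sum (f := fun j => Real.exp (ε h * t.gainFn I x h j u v))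
      (fun j _ => (Real.exp_pos _).le) (Finset.mem_univ 0)
  · exact zero_le_one

lemma prod_lam_nonneg (I : ℝ → ℝ) (ε : Fin t.d → ℝ) (x : Fin n → 𝒳) (u : ℝ)
    (v : t.Idx → ℝ) : 0 ≤ ∏ h, t.lam I ε x h u v :=
  Finset.prod_nonneg fun h _ => t.lam_nonneg I ε x h u v

lemma prod_lam_le_one (I : ℝ → ℝ) (ε : Fin t.d → ℝ) (x : Fin n → 𝒳) (u : ℝ)
    (v : t.Idx → ℝ) : ∏ h, t.lam I ε x h u v ≤ 1 :=
  Finset.prod_le_one (fun h _ => t.lam_nonneg I ε x h u v) fun h _ => t.lam_le_one I ε x h u v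

end TreeFit

/-! ### Smooth information measures -/

lemma SmoothInformation.continuousOn {I : ℝ → ℝ} (hI : SmoothInformation I) :
    ContinuousOn I (Set.Ioo 0 1) := by
  have := hI.1 0 (by norm_num)
  rw [iteratedDeriv_zero] at this
  exact this.continuousOn

lemma SmoothInformation.exists_bound {I : ℝ → ℝ} (hI : SmoothInformation I) :
    ∃ B, ∀ p ∈ Set.Icc (0 : ℝ) 1, |I p| ≤ B := by
  obtain ⟨C, hC⟩ := hI.2 0 (by norm_num)
  rw [iteratedDeriv_zero] at hC
  refine ⟨max C (max |I 0| |I 1|), fun p hp => ?_⟩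
  rcases hp.1.eq_or_lt with h0 | h0
  · subst h0; exact le_max_of_le_right (le_max_left _ _)
  rcases hp.2.eq_or_lt with h1 | h1
  · subst h1; exact le_max_of_le_right (le_max_right _ _)
  · exact le_max_of_le_left (hC p ⟨h0, h1⟩)

lemma SmoothInformation.exists_uniform {I : ℝ → ℝ} (hI : SmoothInformation I) {a : ℝ}
    (ha : 0 < a) {τ : ℝ} (hτ : 0 < τ) : ∃ ρ > 0, ∀ p ∈ Set.Icc a (1 - a), ∀ r, |r - p| ≤ ρ →
      r ∈ Set.Ioo (0 : ℝ) 1 ∧ |I r - I p| ≤ τ := by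
  have hsub : Set.Icc (a / 2) (1 - a / 2) ⊆ Set.Ioo (0 : ℝ) 1 := fun r hr =>
    ⟨by linarith [hr.1], by linarith [hr.2]⟩
  have hu := isCompact_Icc.uniformContinuousOn_of_continuous (hI.continuousOn.mono hsub)
  obtain ⟨δ, hδ, h⟩ := Metric.uniformContinuousOn_iff.1 hu τ hτ
  -- `a / 2` keeps `r` in the larger compact interval; `δ / 2` gives the strict inequality `< δ`.
  refine ⟨min (a / 2) (δ / 2), by positivity, fun p hp r hr => ?_⟩
  have h1 := abs_le.1 (hr.trans (min_le_left _ _))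
  have h2 := hr.trans (min_le_right _ _)
  have hr' : r ∈ Set.Icc (a / 2) (1 - a / 2) :=
    ⟨by linarith [hp.1], by linarith [hp.2]⟩
  have hp' : p ∈ Set.Icc (a / 2) (1 - a / 2) :=
    ⟨by linarith [hp.1], by linarith [hp.2]⟩
  exact ⟨hsub hr', (h r hr' p hp' (by rw [Real.dist_eq]; linarith)).le⟩

namespace TreeFit

variable {𝒳 : Type*} (t : TreeFit 𝒳) {n : ℕ}

/-! ### The selection probability -/

lemma selProb_le_one (I : ℝ → ℝ) (ε : Fin t.d → ℝ) (x : Fin n → 𝒳) (r : Set 𝒳 → ℝ) :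
    t.selProb I ε x r ≤ 1 := softProd_le_one _ _

lemma selProb_pos (I : ℝ → ℝ) (ε : Fin t.d → ℝ) (x : Fin n → 𝒳) (r : Set 𝒳 → ℝ) :
    0 < t.selProb I ε x r := softProd_pos _ _

/-- The impurity is bounded on the closed interval, its values at 0 and 1 included, so all gains are
at most `2 B` in absolute value and the bound is uniform over samples and proportions. -/
lemma exists_le_selProb {I : ℝ → ℝ} (hI : SmoothInformation I) (ε : Fin t.d → ℝ) :
    ∃ c > 0, ∀ (n : ℕ) (x : Fin n → 𝒳) (r : Set 𝒳 → ℝ), (∀ R, r R ∈ Set.Icc (0 : ℝ) 1) →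
      c ≤ t.selProb I ε x r := by
  obtain ⟨B, hB⟩ := hI.exists_bound
  have := softProd_pos (k := t.k) ε (fun _ _ => 0)
  exact ⟨(Real.exp (2 * (2 * B) * ∑ h, |ε h|))⁻¹ * softProd (k := t.k) ε (fun _ _ => 0),
    by positivity, fun n x r hr => le_softProd ε fun h j =>
      abs_gainAt_le hB x hr (t.cand_subset h j)⟩

/-- The radius `ρ` serves all `n` and all designs, because the weights in a gain lie in [0, 1]. The
closeness also places `r` inside (0, 1), where `λ_h` is given by its formula. -/
lemma exists_selProb_close {I : ℝ → ℝ} (hI : SmoothInformation I) (ε : Fin t.d → ℝ) {a : ℝ}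
    (ha : 0 < a) {ω : ℝ} (hω : 0 < ω) : ∃ ρ > 0, ∀ (n : ℕ) (x : Fin n → 𝒳) (r r' : Set 𝒳 → ℝ),
      (∀ R ∈ t.regions, r' R ∈ Set.Icc a (1 - a)) → (∀ R ∈ t.regions, |r R - r' R| ≤ ρ) →
      (∀ R ∈ t.regions, r R ∈ Set.Ioo (0 : ℝ) 1) ∧
        |t.selProb I ε x r - t.selProb I ε x r'| ≤ ω := by
  have hlim : Tendsto (fun τ : ℝ => Real.exp (2 * (2 * τ) * ∑ h, |ε h|) - 1) (𝓝[>] 0) (𝓝 0) := by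
    have : Continuous fun τ : ℝ => Real.exp (2 * (2 * τ) * ∑ h, |ε h|) - 1 := by fun_prop
    exact tendsto_nhdsWithin_of_tendsto_nhds (by simpa using this.tendsto 0)
  obtain ⟨τ, hτω, hτ⟩ := ((hlim.eventually (gt_mem_nhds hω)).and self_mem_nhdsWithin).exists
  replace hτ : 0 < τ := hτ
  obtain ⟨ρ, hρ, h⟩ := hI.exists_uniform ha hτ
  refine ⟨ρ, hρ, fun n x r r' hr' hr => ⟨fun R hR => (h _ (hr' R hR) _ (hr R hR)).1, ?_⟩⟩
  have hI' : ∀ R ∈ t.regions, |I (r R) - I (r' R)| ≤ τ := fun R hR =>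
    (h _ (hr' R hR) _ (hr R hR)).2
  refine (abs_softProd_sub_le ε (by positivity) fun h j => ?_).trans hτω.le
  exact abs_gainAt_sub_le x (t.cand_subset h j) (hI' _ (t.node_mem_regions h))
    (hI' _ (t.cand_mem_regions h j)) (hI' _ (t.diff_mem_regions h j))

/-! ### Consequences of the model -/

lemma theta_eq (x : Fin n → 𝒳) (π : Fin (t.m + 1) → ℝ) {i : Fin n} {j : Fin (t.m + 1)}
    (hj : x i ∈ t.leaf j) : t.theta x π i = π j := by
  rw [theta, Finset.sum_eq_single j]
  · simp [hj]
  · intro j' _ hne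
    have : x i ∉ t.leaf j' := fun h => Set.disjoint_left.1 (t.leaf_disjoint hne) h hj
    simp [this]
  · simp

lemma theta_mem (x : Fin n → 𝒳) {π : Fin (t.m + 1) → ℝ} {A : Set ℝ} (hπ : ∀ j, π j ∈ A)
    (i : Fin n) : t.theta x π i ∈ A := by
  obtain ⟨j, hj⟩ := Set.mem_iUnion.1 (t.leaf_cover ▸ Set.mem_univ (x i))
  rw [t.theta_eq x π hj]
  exact hπ j

/-- The mean proportion of the leaf of interest is its parameter. -/
lemma avg_theta_leaf (x : Fin n → 𝒳) (π : Fin (t.m + 1) → ℝ)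
    (hl : 0 < count x (t.leaf 0)) : avg x (t.theta x π) (t.leaf 0) = π 0 := by
  classical
  have hl0 : (count x (t.leaf 0) : ℝ) ≠ 0 := by exact_mod_cast hl.ne'
  have h := count_mul_avg x (t.theta x π) hl
  have h2 : ∑ i, t.theta x π i * (if x i ∈ t.leaf 0 then 1 else 0) =
      π 0 * count x (t.leaf 0) := by
    rw [← sum_ite_mem, Finset.mul_sum]
    refine Finset.sum_congr rfl fun i _ => ?_
    by_cases hi : x i ∈ t.leaf 0
    · rw [t.theta_eq x π hi]
    · simp [hi]
  rw [h2, mul_comm] at h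
  exact mul_right_cancel₀ hl0 h

namespace IsModel

variable {t} {Ω : Type*} [MeasurableSpace Ω] {P : Measure Ω} {I : ℝ → ℝ} {ε : Fin t.d → ℝ}
  {x : Fin n → 𝒳} {π : Fin (t.m + 1) → ℝ} {Y : Fin n → Ω → Bool}
  {S : (h : Fin t.d) → Ω → Fin (t.k h + 1)}

lemma measurable_outcomes (hM : t.IsModel P I ε x π Y S) :
    Measurable fun ω i => Y i ω := measurable_pi_lambda _ hM.measurable_Y

lemma measurableSet_observed (hM : t.IsModel P I ε x π Y S) : MeasurableSet (t.observed S) := by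
  have : t.observed S = ⋂ h, S h ⁻¹' {0} := by ext; simp [observed]
  rw [this]
  exact MeasurableSet.iInter fun h => hM.measurable_S h (measurableSet_singleton _)

lemma measurable_comp (hM : t.IsModel P I ε x π Y S) {β : Type*} [MeasurableSpace β]
    (g : (Fin n → Bool) → β) : Measurable fun ω => g fun i => Y i ω :=
  (measurable_of_finite g).comp hM.measurable_outcomes

lemma integral_comp (hM : t.IsModel P I ε x π Y S) {E : Type*} [NormedAddCommGroup E]
    [NormedSpace ℝ E] [CompleteSpace E] (F : Bool → E) (i : Fin n) :
    ∫ ω, F (Y i ω) ∂P = t.theta x π i • F true + (1 - t.theta x π i) • F false := by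
  have := hM.isProb
  have hY := hM.measurable_Y i
  have h1 : (P.map (Y i)).real {true} = t.theta x π i := by
    rw [map_measureReal_apply hY (measurableSet_singleton _), ← hM.bernoulli i]; rfl
  have h2 : (P.map (Y i)).real {false} = 1 - t.theta x π i := by
    have : IsProbabilityMeasure (P.map (Y i)) := Measure.isProbabilityMeasure_map hY.aemeasurable
    rw [← h1, ← probReal_compl_eq_one_sub (measurableSet_singleton _)]
    congr 1
    ext b; cases b <;> simp
  rw [← integral_map (f := F) hY.aemeasurable
    (StronglyMeasurable.of_discrete (f := F)).aestronglyMeasurable, integral_fintype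
    (.of_finite), Fintype.sum_bool, h1, h2]

/-- Given the outcomes, the observed splits have probability `selProb`. The outcome vector takes
finitely many values, so this is the mechanism identity summed over them. -/
lemma setIntegral_observed (hM : t.IsModel P I ε x π Y S) {E : Type*} [NormedAddCommGroup E]
    [NormedSpace ℝ E] [CompleteSpace E] (g : (Fin n → Bool) → E) :
    ∫ ω in t.observed S, g (fun i => Y i ω) ∂P =
      ∫ ω, t.selProb I ε x (prop x fun i => Y i ω) • g (fun i => Y i ω) ∂P := by
  have := hM.isProb
  have hY := hM.measurable_outcomes
  have hsm : ∀ f : (Fin n → Bool) → E, StronglyMeasurable f := fun f => .of_discrete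
  rw [← integral_map (f := g) hY.aemeasurable (hsm g).aestronglyMeasurable,
    ← integral_map (f := fun y => t.selProb I ε x (prop x y) • g y) hY.aemeasurable
      (hsm _).aestronglyMeasurable, integral_fintype .of_finite,
    integral_fintype .of_finite]
  refine Finset.sum_congr rfl fun y _ => ?_
  rw [smul_smul, map_measureReal_apply hY (measurableSet_singleton _),
    map_measureReal_apply hY (measurableSet_singleton _),
    measureReal_restrict_apply (hY (measurableSet_singleton _))]
  congr 1
  have hm := hM.mechanism y fun _ => 0
  rw [prod_splitProb] at hm
  convert hm using 2
  · ext ω; simp [observed, funext_iff]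
  · congr 1; ext ω; simp [funext_iff]

lemma integrable_comp (hM : t.IsModel P I ε x π Y S) {E : Type*} [NormedAddCommGroup E]
    (g : (Fin n → Bool) → E) : Integrable (fun ω => g fun i => Y i ω) P := by
  have := hM.isProb
  have : Integrable g (P.map fun ω i => Y i ω) := .of_finite
  exact this.comp_measurable hM.measurable_outcomes

lemma measureReal_observed (hM : t.IsModel P I ε x π Y S) :
    P.real (t.observed S) = ∫ ω, t.selProb I ε x (prop x fun i => Y i ω) ∂P := by
  simpa using hM.setIntegral_observed (E := ℝ) fun _ => 1

lemma le_measureReal_observed (hM : t.IsModel P I ε x π Y S) {c : ℝ}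
    (hc : ∀ r : Set 𝒳 → ℝ, (∀ R, r R ∈ Set.Icc (0 : ℝ) 1) → c ≤ t.selProb I ε x r) :
    c ≤ P.real (t.observed S) := by
  have := hM.isProb
  rw [hM.measureReal_observed]
  calc c = ∫ _, c ∂P := by simp
    _ ≤ _ := integral_mono (integrable_const _)
      (hM.integrable_comp fun y => t.selProb I ε x (prop x y))
      fun ω => hc _ (prop_mem_unit x _)

/-- Softmax probabilities never vanish, so the conditional law is a probability measure for every
`n`, not only for large ones. -/
lemma isProbabilityMeasure_cond (hM : t.IsModel P I ε x π Y S) :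
    IsProbabilityMeasure P[|t.observed S] := by
  have := hM.isProb
  refine cond_isProbabilityMeasure fun h0 => ?_
  have h1 : 0 < P.real (t.observed S) := by
    rw [hM.measureReal_observed]
    refine (integral_pos_iff_support_of_nonneg (fun ω => (t.selProb_pos _ _ _ _).le)
      (hM.integrable_comp fun y => t.selProb I ε x (prop x y))).2 ?_
    have : (Function.support fun ω => t.selProb I ε x (prop x fun i => Y i ω)) = Set.univ := by
      ext ω; simp [(t.selProb_pos _ _ _ _).ne']
    rw [this]; simp
  rw [Measure.real, h0] at h1
  simp at h1

lemma cond_real_le (hM : t.IsModel P I ε x π Y S) {c : ℝ} (hc0 : 0 < c)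
    (hc : c ≤ P.real (t.observed S)) (A : Set Ω) :
    (P[|t.observed S]).real A ≤ P.real A / c := by
  have := hM.isProb
  rw [Measure.real, cond_apply hM.measurableSet_observed, ENNReal.toReal_mul, ENNReal.toReal_inv,
    ← Measure.real, ← Measure.real, inv_mul_eq_div]
  have : P.real (t.observed S ∩ A) ≤ P.real A := measureReal_mono Set.inter_subset_right
  gcongr

/-- Conditioning on the selection event changes expectations of functions of the outcomes only by
the fluctuations of the selection probability. -/
lemma norm_integral_cond_sub_le (hM : t.IsModel P I ε x π Y S) {E : Type*} [NormedAddCommGroup E]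
    [NormedSpace ℝ E] [CompleteSpace E] {g : (Fin n → Bool) → E} (hg : ∀ y, ‖g y‖ ≤ 1)
    {c₀ c : ℝ} (hc₀ : 0 < c₀) (hobs : c₀ ≤ P.real (t.observed S)) :
    ‖∫ ω, g (fun i => Y i ω) ∂P[|t.observed S] - ∫ ω, g (fun i => Y i ω) ∂P‖ ≤
      2 * (∫ ω, |t.selProb I ε x (prop x fun i => Y i ω) - c| ∂P) / c₀ := by
  have := hM.isProb
  set q : Ω → ℝ := fun ω => t.selProb I ε x (prop x fun i => Y i ω) with hq
  set G : Ω → E := fun ω => g fun i => Y i ω with hG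
  set p := P.real (t.observed S) with hp
  set e := ∫ ω, |q ω - c| ∂P with he
  have hp0 : 0 < p := hc₀.trans_le hobs
  have hqi : Integrable q P := hM.integrable_comp fun y => t.selProb I ε x (prop x y)
  have hGi : Integrable G P := hM.integrable_comp g
  have hqGi : Integrable (fun ω => q ω • G ω) P :=
    hM.integrable_comp fun y => t.selProb I ε x (prop x y) • g y
  have hcGi : Integrable (fun ω => c • G ω) P := hGi.smul c
  have habs : Integrable (fun ω => |q ω - c|) P := (hqi.sub (integrable_const c)).abs
  have h1 : ‖∫ ω, q ω • G ω ∂P - c • ∫ ω, G ω ∂P‖ ≤ e := by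
    rw [← integral_smul, ← integral_sub hqGi hcGi]
    refine (norm_integral_le_integral_norm _).trans (integral_mono ?_ habs fun ω => ?_)
    · exact (hqGi.sub hcGi).norm
    · dsimp only
      rw [← sub_smul, norm_smul, Real.norm_eq_abs]
      exact mul_le_of_le_one_right (abs_nonneg _) (hg _)
  have h2 : |p - c| ≤ e := by
    have : p - c = ∫ ω, (q ω - c) ∂P := by
      rw [integral_sub hqi (integrable_const c), hp, hM.measureReal_observed]
      simp [hq]
    rw [this]
    exact abs_integral_le_integral_abs
  have h3 : ‖∫ ω, G ω ∂P‖ ≤ 1 := by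
    refine (norm_integral_le_of_norm_le_const (ae_of_all _ fun ω => hg _)).trans ?_
    simp
  have h4 : ∫ ω, G ω ∂P[|t.observed S] = p⁻¹ • ∫ ω, q ω • G ω ∂P := by
    rw [ProbabilityTheory.cond, integral_smul_measure, ENNReal.toReal_inv, ← Measure.real,
      hG, hM.setIntegral_observed g]
  -- The conditional mean is `E[q G] / p`. Replacing both `q` and `p` by the constant `c` would give
  -- `E[G]`; each replacement costs at most `e`.
  have h5 : ∫ ω, G ω ∂P[|t.observed S] - ∫ ω, G ω ∂P =
      p⁻¹ • ((∫ ω, q ω • G ω ∂P - c • ∫ ω, G ω ∂P) - (p - c) • ∫ ω, G ω ∂P) := by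
    rw [h4, smul_sub, smul_sub, sub_smul, smul_sub, smul_smul p⁻¹ p, inv_mul_cancel₀ hp0.ne',
      one_smul]
    abel
  rw [h5, norm_smul, norm_inv, Real.norm_of_nonneg hp0.le, inv_mul_eq_div]
  have h6 : ‖(∫ ω, q ω • G ω ∂P - c • ∫ ω, G ω ∂P) - (p - c) • ∫ ω, G ω ∂P‖ ≤ 2 * e := by
    refine (norm_sub_le _ _).trans ?_
    rw [norm_smul, Real.norm_eq_abs]
    have : |p - c| * ‖∫ ω, G ω ∂P‖ ≤ |p - c| := mul_le_of_le_one_right (abs_nonneg _) h3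
    linarith
  have he0 : 0 ≤ e := (abs_nonneg _).trans h2
  gcongr

/-! ### Concentration of the proportions and the characteristic function of the leaf statistic -/

open Classical in
lemma prob_abs_prop_sub_le (hM : t.IsModel P I ε x π Y S) {R : Set 𝒳} (hR : 0 < count x R)
    {δ : ℝ} (hδ : 0 < δ) :
    P.real {ω | δ < |prop x (fun i => Y i ω) R - avg x (t.theta x π) R|} ≤
      1 / (count x R * δ ^ 2) := by
  have := hM.isProb
  have hR0 : (0 : ℝ) < count x R := by exact_mod_cast hR
  set Z : Fin n → Ω → ℝ := fun i ω => ((Y i ω).toNat : ℝ) * (if x i ∈ R then 1 else 0) with hZ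
  have hZm : ∀ i, Measurable (Z i) := fun i =>
    (measurable_of_finite fun b : Bool => (b.toNat : ℝ) * (if x i ∈ R then 1 else 0)).comp
      (hM.measurable_Y i)
  have hZb : ∀ i ω, Z i ω ∈ Set.Icc (0 : ℝ) (if x i ∈ R then 1 else 0) := fun i ω => by
    simp only [hZ]
    cases Y i ω <;> split_ifs <;> simp
  have hZL : ∀ i, MemLp (Z i) 2 P := fun i =>
    MemLp.of_bound (hZm i).aestronglyMeasurable 1 (ae_of_all _ fun ω => by
      have := hZb i ω
      rw [Real.norm_of_nonneg this.1]
      refine this.2.trans ?_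
      split_ifs <;> norm_num)
  have hZi : iIndepFun Z P :=
    hM.indep.comp (fun i (b : Bool) => (b.toNat : ℝ) * (if x i ∈ R then 1 else 0))
      fun i => measurable_of_finite _
  have hvar : Var[∑ i, Z i; P] ≤ count x R := by
    rw [IndepFun.variance_sum (fun i _ => hZL i) fun i _ j _ hij => hZi.indepFun hij,
      ← sum_ite_mem]
    refine Finset.sum_le_sum fun i _ => ?_
    refine (variance_le_sq_of_bounded (ae_of_all _ (hZb i)) (hZm i).aemeasurable).trans ?_
    -- A variable with values in an interval of length 1 has variance at most 1/4, and 1 is enough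
    -- here.
    split_ifs <;> norm_num
  set W : Ω → ℝ := fun ω => (1 / (count x R : ℝ)) * (∑ i, Z i) ω with hW
  have hWp : ∀ ω, W ω = prop x (fun i => Y i ω) R := fun ω => by
    simp [hW, prop, hZ]
  have hWL : MemLp W 2 P := (memLp_finsetSum' _ fun i _ => hZL i).const_mul _
  have hmean : ∫ ω, W ω ∂P = avg x (t.theta x π) R := by
    simp only [hW, Finset.sum_apply]
    rw [integral_const_mul, integral_finsetSum _ fun i _ => (hZL i).integrable (by norm_num), avg]
    congr 1
    refine Finset.sum_congr rfl fun i _ => ?_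
    simp only [hZ]
    rw [integral_mul_const, hM.integral_comp (fun b => (b.toNat : ℝ)) i]
    simp
  have hvarW : Var[W; P] ≤ 1 / (count x R : ℝ) := by
    rw [hW, variance_const_mul]
    calc (1 / (count x R : ℝ)) ^ 2 * Var[∑ i, Z i; P]
        ≤ (1 / (count x R : ℝ)) ^ 2 * (count x R : ℝ) := by gcongr
      _ = 1 / (count x R : ℝ) := by field_simp
  have hch := meas_ge_le_variance_div_sq hWL hδ
  rw [hmean] at hch
  simp only [hWp] at hch
  have h1 : P.real {ω | δ ≤ |prop x (fun i => Y i ω) R - avg x (t.theta x π) R|} ≤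
      Var[W; P] / δ ^ 2 :=
    ENNReal.toReal_le_of_le_ofReal (div_nonneg (variance_nonneg _ _) (by positivity)) hch
  calc P.real {ω | δ < |prop x (fun i => Y i ω) R - avg x (t.theta x π) R|}
      ≤ P.real {ω | δ ≤ |prop x (fun i => Y i ω) R - avg x (t.theta x π) R|} :=
        measureReal_mono fun ω (hω : δ < _) => hω.le
    _ ≤ Var[W; P] / δ ^ 2 := h1
    _ ≤ (1 / count x R) / δ ^ 2 := by gcongr
    _ = _ := by rw [div_div]

/-- The statistic is a sum of independent terms. Inside the leaf they are identically distributed,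
with parameter `π 0`; outside they vanish and contribute the factor 1. -/
lemma charFun_standardized (hM : t.IsModel P I ε x π Y S) (hl : 0 < count x (t.leaf 0))
    (s : ℝ) :
    charFun (P.map fun ω => (t.mainStat x (fun i => Y i ω) - √(count x (t.leaf 0)) * π 0) /
      √(π 0 * (1 - π 0))) s =
      bernoulliChar (π 0) (s / (√(count x (t.leaf 0)) * √(π 0 * (1 - π 0)))) ^
        count x (t.leaf 0) := by
  classical
  have := hM.isProb
  have hl0 : (0 : ℝ) < count x (t.leaf 0) := by exact_mod_cast hl
  have hls : 0 < √(count x (t.leaf 0) : ℝ) := Real.sqrt_pos.2 hl0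
  set N := count x (t.leaf 0) with hN
  set σ := √(π 0 * (1 - π 0)) with hσ
  set f : Fin n → Bool → ℝ := fun i b =>
    if x i ∈ t.leaf 0 then ((b.toNat : ℝ) - π 0) / (√N * σ) else 0 with hf
  have hsum : (fun ω => (t.mainStat x (fun i => Y i ω) - √N * π 0) / σ) =
      fun ω => ∑ i, (f i ∘ Y i) ω := by
    ext ω
    have h1 : ∑ i, (f i ∘ Y i) ω =
        (∑ i, ((Y i ω).toNat : ℝ) * (if x i ∈ t.leaf 0 then 1 else 0) -
          π 0 * ∑ i, (if x i ∈ t.leaf 0 then 1 else 0)) / (√N * σ) := by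
      rw [Finset.mul_sum, ← Finset.sum_sub_distrib, Finset.sum_div]
      refine Finset.sum_congr rfl fun i _ => ?_
      by_cases hi : x i ∈ t.leaf 0 <;> simp [hf, hi]
    rw [h1, sum_ite_mem, ← hN, ← count_mul_avg x (fun i => ((Y i ω).toNat : ℝ)) hl, ← prop_eq_avg,
      ← hN, mainStat, ← hN]
    have h2 : (N : ℝ) * prop x (fun i => Y i ω) (t.leaf 0) - π 0 * N =
        √N * (√N * prop x (fun i => Y i ω) (t.leaf 0) - √N * π 0) := by
      have : (N : ℝ) = √N * √N := (Real.mul_self_sqrt hl0.le).symm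
      linear_combination (prop x (fun i => Y i ω) (t.leaf 0) - π 0) * this
    rw [h2, mul_div_mul_left _ _ hls.ne']
  have hind : iIndepFun (fun i => f i ∘ Y i) P := hM.indep.comp f fun i => measurable_of_finite _
  have hmeas : ∀ i, AEMeasurable (f i ∘ Y i) P := fun i =>
    ((measurable_of_finite _).comp (hM.measurable_Y i)).aemeasurable
  rw [hsum, hind.charFun_map_fun_sum_eq_prod hmeas, Finset.prod_apply]
  have hfac : ∀ i, charFun (P.map (f i ∘ Y i)) s =
      if x i ∈ t.leaf 0 then bernoulliChar (π 0) (s / (√N * σ)) else 1 := by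
    intro i
    rw [charFun_map_real (hmeas i)]
    have := hM.integral_comp (fun b => Complex.exp ((s * f i b : ℝ) * Complex.I)) i
    simp only [Function.comp]
    rw [this]
    by_cases hi : x i ∈ t.leaf 0
    · rw [t.theta_eq x π hi, if_pos hi, bernoulliChar]
      simp only [hf, if_pos hi, Complex.real_smul]
      congr 5 <;> simp <;> ring
    · simp only [hf, if_neg hi, mul_zero, Complex.ofReal_zero, zero_mul, Complex.exp_zero]
      rw [← add_smul]; simp
  simp_rw [hfac]
  rw [Finset.prod_ite]
  simp [hN, count]

end IsModel

end TreeFit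

namespace TreeFit

variable {𝒳 : Type*} (t : TreeFit 𝒳) {n : ℕ}

/-! ### Measurability of the pivot -/

lemma measurableSet_scaledDomain (η : Fin 8 → ℝ) : MeasurableSet (scaledDomain η) := by
  unfold scaledDomain
  refine MeasurableSet.inter ?_ (MeasurableSet.inter ?_ ?_) <;>
    exact measurableSet_Ioo.preimage (by fun_prop)

lemma measurableSet_domain_section (x : Fin n → 𝒳) (v : t.Idx → ℝ) :
    MeasurableSet {u | (u, v) ∈ t.domain x} := by
  have : {u | (u, v) ∈ t.domain x} = ⋂ h, ⋂ j, (fun u : ℝ => (u, v ⟨h, 0⟩, t.childEntry v h j)) ⁻¹'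
      scaledDomain (t.eta x h j) := by
    ext; simp [domain]
  rw [this]
  exact MeasurableSet.iInter fun h => MeasurableSet.iInter fun j =>
    (measurableSet_scaledDomain _).preimage (by fun_prop)

-- On the domain the impurity is only evaluated inside (0, 1). Cutting it off outside changes
-- nothing, and turns continuity on (0, 1) into global measurability.
open Classical in
lemma lam_indicator (I : ℝ → ℝ) (ε : Fin t.d → ℝ) (x : Fin n → 𝒳) (h : Fin t.d) (u : ℝ)
    (v : t.Idx → ℝ) : t.lam ((Set.Ioo 0 1).indicator I) ε x h u v = t.lam I ε x h u v := by
  by_cases hu : (u, v) ∈ t.domain x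
  · rw [lam, lam, if_pos hu, if_pos hu]
    have hg : ∀ j, t.gainFn ((Set.Ioo 0 1).indicator I) x h j u v = t.gainFn I x h j u v := by
      intro j
      obtain ⟨h1, h2, h3⟩ := hu h j
      simp only [gainFn, scaledGain]
      rw [Set.indicator_of_mem h1, Set.indicator_of_mem h2, Set.indicator_of_mem h3]
    simp only [hg]
  · rw [lam, lam, if_neg hu, if_neg hu]

lemma measurable_lam {I : ℝ → ℝ} (hI : ContinuousOn I (Set.Ioo 0 1)) (ε : Fin t.d → ℝ)
    (x : Fin n → 𝒳) (h : Fin t.d) (v : t.Idx → ℝ) : Measurable fun u => t.lam I ε x h u v := by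
  classical
  simp only [← t.lam_indicator I]
  set J := (Set.Ioo 0 1).indicator I with hJ
  have hJm : Measurable J := by
    rw [hJ, ← Set.piecewise_eq_indicator]
    exact hI.measurable_piecewise continuousOn_const measurableSet_Ioo
  have hg : ∀ j, Measurable fun u => t.gainFn J x h j u v := fun j => by
    simp only [gainFn, scaledGain]
    exact ((hJm.comp (by fun_prop)).sub (measurable_const.mul (hJm.comp (by fun_prop)))).sub
      (measurable_const.mul (hJm.comp (by fun_prop)))
  unfold lam
  exact Measurable.ite (t.measurableSet_domain_section x v) (by fun_prop) measurable_const

lemma measurable_prod_lam {I : ℝ → ℝ} (hI : ContinuousOn I (Set.Ioo 0 1)) (ε : Fin t.d → ℝ)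
    (x : Fin n → 𝒳) (v : t.Idx → ℝ) : Measurable fun u => ∏ h, t.lam I ε x h u v :=
  Finset.measurable_fun_prod _ fun h _ => t.measurable_lam hI ε x h v

lemma measurable_pivot {I : ℝ → ℝ} (hI : ContinuousOn I (Set.Ioo 0 1)) (ε : Fin t.d → ℝ)
    (x : Fin n → 𝒳) (s : ℝ) (v : t.Idx → ℝ) (mean : ℝ) :
    Measurable fun σ2 => t.pivot I ε x s v mean σ2 := by
  have hm : Measurable fun w : ℝ × ℝ => t.pivotDensity I ε x v mean w.1 w.2 := by
    have h1 : Measurable fun w : ℝ × ℝ => gaussianPDFReal mean w.1.toNNReal w.2 :=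
      measurable_uncurry_gaussianPDFReal.comp
        (f := fun w : ℝ × ℝ => (mean, w.1.toNNReal, w.2)) (by fun_prop)
    exact h1.mul ((t.measurable_prod_lam hI ε x v).comp measurable_snd)
  unfold pivot
  exact (hm.stronglyMeasurable.integral_prod_right (ν := volume.restrict (Set.Iic s))).measurable.div
    (hm.stronglyMeasurable.integral_prod_right (ν := volume)).measurable

/-- The variance estimator need not be a function of the outcomes. As these take finitely many
values, joint measurability reduces to measurability in the estimator for each fixed outcome. -/
lemma IsModel.measurable_comp_prod {Ω : Type*} [MeasurableSpace Ω] {P : Measure Ω} {I : ℝ → ℝ}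
    {ε : Fin t.d → ℝ} {x : Fin n → 𝒳} {π : Fin (t.m + 1) → ℝ} {Y : Fin n → Ω → Bool}
    {S : (h : Fin t.d) → Ω → Fin (t.k h + 1)} (hM : t.IsModel P I ε x π Y S)
    {F : (Fin n → Bool) → ℝ → ℝ} (hF : ∀ y, Measurable (F y)) {σ2 : Ω → ℝ}
    (hσ : Measurable σ2) : Measurable fun ω => F (fun i => Y i ω) (σ2 ω) := by
  have h : Measurable fun w : (Fin n → Bool) × ℝ => F w.1 w.2 :=
    measurable_from_prod_countable_right hF
  exact h.comp (hM.measurable_outcomes.prodMk hσ)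

lemma IsModel.measurable_pivot {Ω : Type*} [MeasurableSpace Ω] {P : Measure Ω} {I : ℝ → ℝ}
    {ε : Fin t.d → ℝ} {x : Fin n → 𝒳} {π : Fin (t.m + 1) → ℝ} {Y : Fin n → Ω → Bool}
    {S : (h : Fin t.d) → Ω → Fin (t.k h + 1)} (hM : t.IsModel P I ε x π Y S)
    (hI : ContinuousOn I (Set.Ioo 0 1)) {σ2 : Ω → ℝ} (hσ : Measurable σ2) (mean : ℝ) :
    Measurable fun ω => t.pivot I ε x (t.mainStat x fun i => Y i ω)
      (t.restStat x fun i => Y i ω) mean (σ2 ω) :=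
  IsModel.measurable_comp_prod t hM
    (F := fun y σ2 => t.pivot I ε x (t.mainStat x y) (t.restStat x y) mean σ2)
    (fun y => TreeFit.measurable_pivot t hI ε x (t.mainStat x y) (t.restStat x y) mean) hσ

/-! ### The pivot and the normal distribution function -/

lemma abs_div_sqrt_sub_le {z L w κ s σ : ℝ} (hz : |z| ≤ L) (hw : 0 < w) (hs : w ^ 2 ≤ s)
    (hσ : w ^ 2 ≤ σ) (hκ : |s - σ| ≤ κ) : |z / √s - z / √σ| ≤ L * κ / (2 * w ^ 3) := by
  have h1 : w ≤ √s := Real.le_sqrt_of_sq_le hs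
  have h2 : w ≤ √σ := Real.le_sqrt_of_sq_le hσ
  have hs0 : 0 < √s := hw.trans_le h1
  have hσ0 : 0 < √σ := hw.trans_le h2
  have hL : 0 ≤ L := (abs_nonneg z).trans hz
  have hκ0 : 0 ≤ κ := (abs_nonneg _).trans hκ
  have he : z / √s - z / √σ = z * (σ - s) / (√s * √σ * (√s + √σ)) := by
    have : σ - s = (√σ - √s) * (√s + √σ) := by
      have e1 := Real.sq_sqrt ((sq_nonneg w).trans hs)
      have e2 := Real.sq_sqrt ((sq_nonneg w).trans hσ)
      linear_combination e1 - e2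
    rw [this]
    field_simp
  rw [he, abs_div, abs_mul, abs_of_pos (by positivity : 0 < √s * √σ * (√s + √σ)), abs_sub_comm σ s]
  have hden : 2 * w ^ 3 ≤ √s * √σ * (√s + √σ) := by
    calc 2 * w ^ 3 = w * w * (w + w) := by ring
      _ ≤ _ := by gcongr
  gcongr

/-- Two errors: the tilt, with the estimated variance on both sides, then the change from estimated
to true variance inside `Φ`. The bound `s2 ≤ 1` makes the Chebyshev term independent of the
estimate. -/
lemma abs_pivot_sub_le {I : ℝ → ℝ} (hI : ContinuousOn I (Set.Ioo 0 1)) (ε : Fin t.d → ℝ)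
    (x : Fin n → 𝒳) {s m L κ w c₀ c ω s2 σ2 : ℝ} {v : t.Idx → ℝ} (hs : |s - m| ≤ L)
    (hw : 0 < w) (hs2 : w ^ 2 ≤ s2) (hs21 : s2 ≤ 1) (hσ2 : w ^ 2 ≤ σ2) (hκ : |s2 - σ2| ≤ κ)
    (hc₀ : 0 < c₀) (hc : c₀ ≤ c) (hc1 : c ≤ 1) (hL : 0 < L) (hω : 0 ≤ ω)
    (h : ∀ u, |u - m| ≤ L → |∏ h, t.lam I ε x h u v - c| ≤ ω) (he : ω + 1 / L ^ 2 ≤ c₀ / 2) :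
    |t.pivot I ε x s v m s2 - stdCDF ((s - m) / √σ2)| ≤
      4 * (ω + 1 / L ^ 2) / c₀ + L * κ / (2 * w ^ 3) := by
  have hs20 : 0 < s2 := (by positivity : 0 < w ^ 2).trans_le hs2
  have hv : s2.toNNReal ≠ 0 := by simpa using hs20
  have hcoe : ((s2.toNNReal : NNReal) : ℝ) = s2 := Real.coe_toNNReal _ hs20.le
  have hle : s2 / L ^ 2 ≤ 1 / L ^ 2 := by gcongr
  have h1 := abs_tilted_ratio_sub_stdCDF_le (s := s) hv (t.measurable_prod_lam hI ε x v)
    (fun u => t.prod_lam_nonneg I ε x u v) (fun u => t.prod_lam_le_one I ε x u v) hc₀ hc hc1 hL hω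
    h (by rw [hcoe]; linarith)
  rw [hcoe] at h1
  have h2 : 4 * (ω + s2 / L ^ 2) / c₀ ≤ 4 * (ω + 1 / L ^ 2) / c₀ := by gcongr
  have h3 := (abs_stdCDF_sub_le ((s - m) / √s2) ((s - m) / √σ2)).trans
    (abs_div_sqrt_sub_le hs hw hs2 hσ2 hκ)
  refine (abs_sub_le _ (stdCDF ((s - m) / √s2)) _).trans (add_le_add (h1.trans h2) h3)

/-! ### Asymptotics -/

lemma exists_params_mem_Icc {π : ℕ → Fin (t.m + 1) → ℝ}
    (hπ : ∀ n j, π n j ∈ Set.Ioo (0 : ℝ) 1) (h : t.ParamsBounded π) :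
    ∃ a > 0, ∀ᶠ n in atTop, ∀ j, π n j ∈ Set.Icc a (1 - a) := by
  have key : ∀ j, ∃ a > 0, ∀ᶠ n in atTop, π n j ∈ Set.Icc a (1 - a) := by
    intro j
    obtain ⟨a, ha0, ha⟩ := exists_between (h j).1
    obtain ⟨b, hb, hb1⟩ := exists_between (h j).2
    have e1 := Filter.eventually_lt_of_lt_liminf ha
      (isBoundedUnder_of ⟨0, fun n => (hπ n j).1.le⟩)
    have e2 := Filter.eventually_lt_of_limsup_lt hb
      (isBoundedUnder_of ⟨1, fun n => (hπ n j).2.le⟩)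
    refine ⟨min a (1 - b), lt_min ha0 (by linarith), ?_⟩
    filter_upwards [e1, e2] with n h1 h2
    exact ⟨(min_le_left _ _).trans h1.le, by linarith [min_le_right a (1 - b)]⟩
  choose a ha0 ha using key
  obtain ⟨j₀, -, hj₀⟩ := Finset.exists_min_image Finset.univ a ⟨0, Finset.mem_univ _⟩
  refine ⟨a j₀, ha0 j₀, (eventually_all.2 ha).mono fun n hn j => ?_⟩
  have := hj₀ j (Finset.mem_univ j)
  exact ⟨this.trans (hn j).1, (hn j).2.trans (by linarith)⟩

section Asymptotics

variable {t} {I : ℝ → ℝ} {ε : Fin t.d → ℝ} {X : (n : ℕ) → Fin n → 𝒳}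
  {π : ℕ → Fin (t.m + 1) → ℝ} {Ω : ℕ → Type*} [∀ n, MeasurableSpace (Ω n)]
  {P : ∀ n, Measure (Ω n)} {Y : ∀ n, Fin n → Ω n → Bool}
  {S : ∀ n, (h : Fin t.d) → Ω n → Fin (t.k h + 1)}

/-- The event that some relevant proportion deviates from its mean by more than `ρ`. -/
def deviation (t : TreeFit 𝒳) {Ω : Type*} (x : Fin n → 𝒳) (π : Fin (t.m + 1) → ℝ)
    (Y : Fin n → Ω → Bool) (ρ : ℝ) : Set Ω :=
  {ω | ∃ R ∈ t.regions, ρ < |prop x (fun i => Y i ω) R - avg x (t.theta x π) R|}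

lemma tendsto_measureReal_deviation
    (hM : ∀ n, t.IsModel (P n) I ε (X n) (π n) (Y n) (S n)) (hX : t.ProportionalGrowth X)
    {ρ : ℝ} (hρ : 0 < ρ) :
    Tendsto (fun n => (P n).real (t.deviation (X n) (π n) (Y n) ρ)) atTop (𝓝 0) := by
  have hfin := t.regions_finite
  have hb : ∀ n, (P n).real (t.deviation (X n) (π n) (Y n) ρ) ≤
      ∑ R ∈ hfin.toFinset, (P n).real
        {ω | ρ < |prop (X n) (fun i => Y n i ω) R - avg (X n) (t.theta (X n) (π n)) R|} := by
    intro n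
    have : t.deviation (X n) (π n) (Y n) ρ = ⋃ R ∈ hfin.toFinset,
        {ω | ρ < |prop (X n) (fun i => Y n i ω) R - avg (X n) (t.theta (X n) (π n)) R|} := by
      ext; simp [deviation]
    rw [this]
    exact measureReal_biUnion_finset_le _ _
  refine squeeze_zero (fun n => measureReal_nonneg) hb ?_
  rw [← Finset.sum_const_zero (s := hfin.toFinset)]
  refine tendsto_finsetSum _ fun R hR => ?_
  have hc := t.tendsto_count hX (hfin.mem_toFinset.1 hR)
  have hlim : Tendsto (fun n => 1 / ((count (X n) R : ℝ) * ρ ^ 2)) atTop (𝓝 0) :=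
    (((tendsto_natCast_atTop_atTop (R := ℝ)).comp hc).atTop_mul_const
      (by positivity)).const_div_atTop 1
  refine squeeze_zero' (Eventually.of_forall fun n => measureReal_nonneg) ?_ hlim
  filter_upwards [hc.eventually_gt_atTop 0] with n hn
  exact (hM n).prob_abs_prop_sub_le hn hρ

lemma eventually_count_pos (hX : t.ProportionalGrowth X) :
    ∀ᶠ n in atTop, ∀ R ∈ t.regions, 0 < count (X n) R :=
  t.regions_finite.eventually_all.2 fun _ hR => (t.tendsto_count hX hR).eventually_gt_atTop 0

/-- The selection probability is asymptotically constant. -/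
lemma tendsto_integral_abs_selProb_sub
    (hM : ∀ n, t.IsModel (P n) I ε (X n) (π n) (Y n) (S n)) (hX : t.ProportionalGrowth X)
    (hπ : t.ParamsBounded π) (hI : SmoothInformation I) :
    Tendsto (fun n => ∫ ω, |t.selProb I ε (X n) (prop (X n) fun i => Y n i ω) -
      t.selProb I ε (X n) (avg (X n) (t.theta (X n) (π n)))| ∂P n) atTop (𝓝 0) := by
  obtain ⟨a, ha, hev⟩ := t.exists_params_mem_Icc (fun n => (hM n).param_mem) hπ
  refine tendsto_order.2 ⟨fun b hb => Eventually.of_forall fun n =>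
    hb.trans_le (integral_nonneg fun _ => abs_nonneg _), fun η hη => ?_⟩
  obtain ⟨ρ, hρ, hclose⟩ := t.exists_selProb_close hI ε ha (half_pos hη)
  filter_upwards [hev, eventually_count_pos hX,
    (tendsto_measureReal_deviation hM hX hρ).eventually (gt_mem_nhds (half_pos hη))]
    with n hn hcount hdev
  have := (hM n).isProb
  set c := t.selProb I ε (X n) (avg (X n) (t.theta (X n) (π n)))
  set A := t.deviation (X n) (π n) (Y n) ρ
  have hA : MeasurableSet A :=
    (hM n).measurable_outcomes (Set.toFinite {y : Fin n → Bool | ∃ R ∈ t.regions,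
      ρ < |prop (X n) y R - avg (X n) (t.theta (X n) (π n)) R|}).measurableSet
  calc ∫ ω, |t.selProb I ε (X n) (prop (X n) fun i => Y n i ω) - c| ∂P n
      ≤ ∫ ω, (η / 2 + A.indicator 1 ω) ∂P n := by
        refine integral_mono
          ((hM n).integrable_comp fun y => |t.selProb I ε (X n) (prop (X n) y) - c|)
          ((integrable_const _).add ((integrable_const 1).indicator hA)) fun ω => ?_
        by_cases hω : ω ∈ A
        · have h1 := t.selProb_pos I ε (X n) (prop (X n) fun i => Y n i ω)
          have h2 := t.selProb_le_one I ε (X n) (prop (X n) fun i => Y n i ω)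
          have h3 : 0 < c := t.selProb_pos _ _ _ _
          have h4 : c ≤ 1 := t.selProb_le_one _ _ _ _
          simp only [hω, Set.indicator_of_mem, Pi.one_apply]
          rw [abs_le]
          constructor <;> linarith
        · simp only [hω, not_false_eq_true, Set.indicator_of_notMem, add_zero]
          simp only [A, deviation, Set.mem_ofPred_eq, not_exists, not_and, not_lt] at hω
          exact (hclose n (X n) _ _
            (fun R hR => avg_mem_Icc _ (t.theta_mem _ hn) (hcount R hR)) hω).2
    _ = η / 2 + (P n).real A := by
        rw [integral_add (integrable_const _) ((integrable_const 1).indicator hA)]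
        simp [integral_indicator_one hA]
    _ < η := by linarith

/-- The standardized first key statistic. -/
def standardized (t : TreeFit 𝒳) (x : Fin n → 𝒳) (π : Fin (t.m + 1) → ℝ) (y : Fin n → Bool) : ℝ :=
  (t.mainStat x y - √(count x (t.leaf 0)) * π 0) / √(π 0 * (1 - π 0))

/-- Conditionally on the observed splits, the standardized first key statistic is asymptotically
standard normal. -/
lemma tendstoInDistribution_standardized
    (hM : ∀ n, t.IsModel (P n) I ε (X n) (π n) (Y n) (S n)) (hX : t.ProportionalGrowth X)
    (hπ : t.ParamsBounded π) (hI : SmoothInformation I)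
    [∀ n, IsProbabilityMeasure (P n)[|t.observed (S n)]] :
    TendstoInDistribution (fun n ω => t.standardized (X n) (π n) fun i => Y n i ω) atTop id
      (fun n => (P n)[|t.observed (S n)]) (gaussianReal 0 1) where
  forall_aemeasurable n := ((hM n).measurable_comp (t.standardized (X n) (π n))).aemeasurable
  aemeasurable_limit := aemeasurable_id
  tendsto := by
    refine ProbabilityMeasure.tendsto_iff_tendsto_charFun.2 fun s => ?_
    simp only [ProbabilityMeasure.coe_mk, Measure.map_id]
    obtain ⟨a, ha, hev⟩ := t.exists_params_mem_Icc (fun n => (hM n).param_mem) hπ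
    -- The unconditional central limit theorem; what remains is to compare conditional and
    -- unconditional characteristic functions.
    have hlim : Tendsto (fun n => charFun ((P n).map fun ω => t.standardized (X n) (π n)
        fun i => Y n i ω) s) atTop (𝓝 (charFun (gaussianReal 0 1) s)) := by
      rw [charFun_gaussianReal]
      have hN := t.tendsto_count hX t.leaf_mem_regions
      have hp : ∀ᶠ n in atTop, 0 ≤ π n 0 ∧ π n 0 ≤ 1 ∧ a ^ 2 ≤ π n 0 * (1 - π n 0) := by
        filter_upwards [hev] with n hn
        obtain ⟨h1, h2⟩ := hn 0
        exact ⟨by linarith, by linarith, by nlinarith⟩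
      have h := tendsto_bernoulliChar_pow hN hp (by positivity) s
      have he : Complex.exp ((s : ℂ) * (0 : ℝ) * Complex.I - ((1 : NNReal) : ℝ) * s ^ 2 / 2) =
          Complex.exp (-s ^ 2 / 2) := by
        congr 1; push_cast; ring
      refine Tendsto.congr' ?_ (by simpa only [he] using h)
      filter_upwards [hN.eventually_gt_atTop 0] with n hn
      exact ((hM n).charFun_standardized hn s).symm
    refine Tendsto.congr_dist hlim ?_
    obtain ⟨c₀, hc₀, hle⟩ := t.exists_le_selProb hI ε
    have hq := (tendsto_integral_abs_selProb_sub hM hX hπ hI).const_mul (2 / c₀)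
    rw [mul_zero] at hq
    refine squeeze_zero (fun n => dist_nonneg) (fun n => ?_) hq
    have hm := (hM n).measurable_comp (t.standardized (X n) (π n))
    rw [dist_comm, dist_eq_norm, charFun_map_real hm.aemeasurable, charFun_map_real hm.aemeasurable,
      div_mul_eq_mul_div]
    exact (hM n).norm_integral_cond_sub_le
      (g := fun y => Complex.exp ((s * t.standardized (X n) (π n) y : ℝ) * Complex.I))
      (fun y => (Complex.norm_exp_ofReal_mul_I _).le) hc₀
      ((hM n).le_measureReal_observed (hle n (X n)))

/-- The correction factor is close to its value at the mean proportions on a neighbourhood of the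
mean of the first key statistic. -/
lemma abs_prod_lam_sub_le {x : Fin n → 𝒳} {y : Fin n → Bool} {θ : Fin n → ℝ} {a ρ ω L m u : ℝ}
    (hclose : ∀ r r' : Set 𝒳 → ℝ, (∀ R ∈ t.regions, r' R ∈ Set.Icc a (1 - a)) →
      (∀ R ∈ t.regions, |r R - r' R| ≤ ρ) → (∀ R ∈ t.regions, r R ∈ Set.Ioo (0 : ℝ) 1) ∧
        |t.selProb I ε x r - t.selProb I ε x r'| ≤ ω)
    (hx : ∀ R ∈ t.regions, 0 < count x R) (hθ : ∀ i, θ i ∈ Set.Icc a (1 - a))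
    (hdev : ∀ R ∈ t.regions, |prop x y R - avg x θ R| ≤ ρ / 2)
    (hs : |t.mainStat x y - m| ≤ L) (hL : 2 * L / √(count x (t.leaf 0)) ≤ ρ / 2)
    (hu : |u - m| ≤ L) :
    |∏ h, t.lam I ε x h u (t.restStat x y) - t.selProb I ε x (avg x θ)| ≤ ω := by
  -- Both `u` and the observed statistic lie within `L` of the mean `m`; the resulting shift of
  -- proportions takes half of `ρ`, and the deviation from the means the other half.
  have h2 : |u - √(count x (t.leaf 0)) * prop x y (t.leaf 0)| ≤ 2 * L := by
    refine (abs_sub_le _ m _).trans ?_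
    rw [abs_sub_comm m]
    have : |√(count x (t.leaf 0)) * prop x y (t.leaf 0) - m| ≤ L := hs
    linarith
  have h3 : ∀ R ∈ t.regions, |shifted x y (t.leaf 0) u R - avg x θ R| ≤ ρ := fun R hR => by
    refine (abs_sub_le _ (prop x y R) _).trans ?_
    have := abs_shifted_sub_le x y (t.leaf 0) u R
    have h4 : |u - √(count x (t.leaf 0)) * prop x y (t.leaf 0)| / √(count x (t.leaf 0)) ≤
        2 * L / √(count x (t.leaf 0)) := by gcongr
    linarith [hdev R hR]
  obtain ⟨h4, h5⟩ := hclose _ _ (fun R hR => avg_mem_Icc x hθ (hx R hR)) h3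
  rwa [prod_lam_restStat I ε hx y u h4]

/-- Chebyshev at distance `L / √n_1` for the leaf proportion: the leaf size cancels, so the bound is
uniform in `n`. -/
lemma prob_abs_mainStat_sub_le {Ω : Type*} [MeasurableSpace Ω] {P : Measure Ω}
    {x : Fin n → 𝒳} {π : Fin (t.m + 1) → ℝ} {Y : Fin n → Ω → Bool}
    {S : (h : Fin t.d) → Ω → Fin (t.k h + 1)} (hM : t.IsModel P I ε x π Y S)
    (hl : 0 < count x (t.leaf 0)) {L : ℝ} (hL : 0 < L) :
    P.real {ω | L < |t.mainStat x (fun i => Y i ω) - √(count x (t.leaf 0)) * π 0|} ≤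
      1 / L ^ 2 := by
  have := hM.isProb
  have hl0 : (0 : ℝ) < count x (t.leaf 0) := by exact_mod_cast hl
  have hls : 0 < √(count x (t.leaf 0) : ℝ) := Real.sqrt_pos.2 hl0
  have h := hM.prob_abs_prop_sub_le hl (div_pos hL hls)
  rw [t.avg_theta_leaf x π hl, div_pow, Real.sq_sqrt hl0.le, mul_div_cancel₀ _ hl0.ne'] at h
  convert h using 4 with ω
  rw [mainStat, ← mul_sub, abs_mul, abs_of_pos hls, div_lt_iff₀ hls, mul_comm]

/-- The pivot differs from the normal distribution function at the standardized first key statistic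
by a quantity that vanishes in probability. -/
lemma tendsto_pivot_sub_stdCDF
    (hM : ∀ n, t.IsModel (P n) I ε (X n) (π n) (Y n) (S n)) (hX : t.ProportionalGrowth X)
    (hπ : t.ParamsBounded π) (hI : SmoothInformation I) {σ2 : ∀ n, Ω n → ℝ}
    (hσ : ∀ δ : ℝ, 0 < δ → Tendsto
      (fun n => (P n).real {ω | δ < |σ2 n ω - π n 0 * (1 - π n 0)|}) atTop (𝓝 0))
    {δ : ℝ} (hδ : 0 < δ) :
    Tendsto (fun n => (P n).real {ω | δ < |t.pivot I ε (X n)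
      (t.mainStat (X n) fun i => Y n i ω) (t.restStat (X n) fun i => Y n i ω)
      (√(count (X n) (t.leaf 0)) * π n 0) (σ2 n ω) -
        stdCDF (t.standardized (X n) (π n) fun i => Y n i ω)|}) atTop (𝓝 0) := by
  obtain ⟨a, ha, hev⟩ := t.exists_params_mem_Icc (fun n => (hM n).param_mem) hπ
  obtain ⟨c₀, hc₀, hle⟩ := t.exists_le_selProb hI ε
  refine tendsto_order.2 ⟨fun b hb => Eventually.of_forall fun n =>
    hb.trans_le measureReal_nonneg, fun η hη => ?_⟩
  -- With `1 / L ^ 2 < ω₀`, the tilting error `e = ω₀ + 1 / L ^ 2` is below `2 ω₀`: the first bound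
  -- gives `e ≤ c₀ / 2`, the second `4 e / c₀ ≤ δ / 2`.
  set ω₀ := min (c₀ / 4) (c₀ * δ / 16) with hω₀
  have hω₀0 : 0 < ω₀ := by positivity
  obtain ⟨L, hL0, hLω, hLη⟩ : ∃ L : ℝ, 0 < L ∧ 1 / L ^ 2 < ω₀ ∧ 1 / L ^ 2 < η / 3 := by
    have hlim : Tendsto (fun L : ℝ => 1 / L ^ 2) atTop (𝓝 0) :=
      (tendsto_pow_atTop two_ne_zero).const_div_atTop 1
    exact ((eventually_gt_atTop 0).and ((hlim.eventually (gt_mem_nhds hω₀0)).and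
      (hlim.eventually (gt_mem_nhds (show 0 < η / 3 by positivity))))).exists
  obtain ⟨ρ, hρ, hclose⟩ := t.exists_selProb_close hI ε ha hω₀0
  set w := a / 2 with hw
  have hw0 : 0 < w := by positivity
  -- In turn, these keep the estimated variance above `a² / 2 ≥ w²`, keep it below `1/4 + 1/2 ≤ 1`,
  -- and make the effect of the estimation error on `Φ` at most `δ / 2`.
  set κ := min (a ^ 2 / 2) (min (1 / 2) (δ * w ^ 3 / L)) with hκ
  have hκ0 : 0 < κ := by positivity
  have hN := t.tendsto_count hX t.leaf_mem_regions
  have hNs : Tendsto (fun n => 2 * L / √(count (X n) (t.leaf 0) : ℝ)) atTop (𝓝 0) :=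
    (Real.tendsto_sqrt_atTop.comp
      ((tendsto_natCast_atTop_atTop (R := ℝ)).comp hN)).const_div_atTop _
  filter_upwards [hev, eventually_count_pos hX,
    hNs.eventually (gt_mem_nhds (half_pos hρ)),
    (tendsto_measureReal_deviation hM hX (half_pos hρ)).eventually
      (gt_mem_nhds (show 0 < η / 3 by positivity)),
    (hσ κ hκ0).eventually (gt_mem_nhds (show 0 < η / 3 by positivity))]
    with n hn hcount hLn hdev hσn
  have := (hM n).isProb
  have hT := prob_abs_mainStat_sub_le (hM n) (hcount _ t.leaf_mem_regions) hL0
  set A₁ := {ω | κ < |σ2 n ω - π n 0 * (1 - π n 0)|}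
  set A₂ := t.deviation (X n) (π n) (Y n) (ρ / 2)
  set A₃ := {ω | L < |t.mainStat (X n) (fun i => Y n i ω) - √(count (X n) (t.leaf 0)) * π n 0|}
  -- Three bad events, each of probability below `η / 3`: poor variance estimate, deviating
  -- proportions, first key statistic outside the window. Off their union the bound is
  -- deterministic.
  refine lt_of_le_of_lt (measureReal_mono (s₂ := A₁ ∪ A₂ ∪ A₃) fun ω hω => ?_)
    (((measureReal_union_le _ _).trans (add_le_add_left (measureReal_union_le _ _) _)).trans_lt
      (by linarith))
  by_contra hgood
  simp only [Set.mem_union, not_or] at hgood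
  obtain ⟨⟨h1, h2⟩, h3⟩ := hgood
  simp only [A₁, Set.mem_ofPred_eq, not_lt] at h1
  simp only [A₂, deviation, Set.mem_ofPred_eq, not_exists, not_and, not_lt] at h2
  simp only [A₃, Set.mem_ofPred_eq, not_lt] at h3
  simp only [Set.mem_ofPred_eq] at hω
  obtain ⟨hp1, hp2⟩ := hn 0
  have hσ1 : a ^ 2 ≤ π n 0 * (1 - π n 0) := by nlinarith
  have hσ2 : π n 0 * (1 - π n 0) ≤ 1 / 4 := by nlinarith [sq_nonneg (π n 0 - 1 / 2)]
  have hκ1 : κ ≤ a ^ 2 / 2 := min_le_left _ _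
  have hκ2 : κ ≤ 1 / 2 := (min_le_right _ _).trans (min_le_left _ _)
  have hκ3 : κ ≤ δ * w ^ 3 / L := (min_le_right _ _).trans (min_le_right _ _)
  have hs := abs_le.1 h1
  have hw2 : w ^ 2 = a ^ 2 / 4 := by rw [hw]; ring
  have ha2 : 0 < a ^ 2 := by positivity
  have hωc : ω₀ ≤ c₀ / 4 := min_le_left _ _
  have hωδ : ω₀ ≤ c₀ * δ / 16 := min_le_right _ _
  have hc := hle n (X n) (avg (X n) (t.theta (X n) (π n)))
    (avg_mem_unit _ fun i => t.theta_mem (A := Set.Icc 0 1) _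
      (fun j => Set.Ioo_subset_Icc_self ((hM n).param_mem j)) i)
  have hfinal := t.abs_pivot_sub_le (s2 := σ2 n ω) hI.continuousOn ε (X n) h3 hw0
    (by linarith) (by linarith) (by linarith : w ^ 2 ≤ π n 0 * (1 - π n 0)) h1 hc₀ hc
    (t.selProb_le_one _ _ _ _) hL0 hω₀0.le
    (fun u hu => abs_prod_lam_sub_le (hclose n (X n)) hcount (t.theta_mem _ hn) h2 h3 hLn.le hu)
    (by linarith)
  have hb1 : 4 * (ω₀ + 1 / L ^ 2) / c₀ ≤ δ / 2 := by
    rw [div_le_iff₀ hc₀]; linarith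
  have hb2 : L * κ / (2 * w ^ 3) ≤ δ / 2 := by
    rw [le_div_iff₀ hL0] at hκ3
    rw [div_le_iff₀ (by positivity)]
    linarith
  exact absurd hω (not_lt.2 (hfinal.trans (by linarith)))

end Asymptotics

end TreeFit

end

end TreeInference

/-! ### Conclusion: conditional consistency and the uniform limit -/

theorem theorem3 {𝒳 : Type*} (t : TreeInference.TreeFit 𝒳) (I : ℝ → ℝ) (ε : Fin t.d → ℝ)
    (X : (n : ℕ) → Fin n → 𝒳) (π : ℕ → Fin (t.m + 1) → ℝ)
    {Ω : ℕ → Type*} [∀ n, MeasurableSpace (Ω n)] (P : ∀ n, Measure (Ω n))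
    (Y : ∀ n, Fin n → Ω n → Bool) (S : ∀ n, (h : Fin t.d) → Ω n → Fin (t.k h + 1))
    (hmodel : ∀ n, t.IsModel (P n) I ε (X n) (π n) (Y n) (S n))
    (hgrowth : t.ProportionalGrowth X)
    (hparams : t.ParamsBounded π)
    (hcov : t.CovNondegenerate P X Y)
    (hI : TreeInference.SmoothInformation I)
    (σ2hat : ∀ n, Ω n → ℝ) (hσ_meas : ∀ n, Measurable (σ2hat n))
    (hσ : ∀ δ : ℝ, 0 < δ → Tendsto
      (fun n => P n {ω | δ < |σ2hat n ω - π n 0 * (1 - π n 0)|}) atTop (𝓝 0)) :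
    (∀ δ : ℝ, 0 < δ → Tendsto
      (fun n => (P n)[{ω | δ < |σ2hat n ω - π n 0 * (1 - π n 0)|} | t.observed (S n)])
        atTop (𝓝 0)) ∧
    ∃ _ : ∀ n, IsProbabilityMeasure (P n)[|t.observed (S n)],
      TendstoInDistribution
        (fun n ω => t.pivot I ε (X n)
          (t.mainStat (X n) fun i => Y n i ω) (t.restStat (X n) fun i => Y n i ω)
          (√(TreeInference.count (X n) (t.leaf 0)) * π n 0) (σ2hat n ω))
        atTop (fun u : unitInterval => (u : ℝ))
        (fun n => (P n)[|t.observed (S n)]) volume := by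
  have hprob := fun n => (hmodel n).isProb
  have hcond := fun n => (hmodel n).isProbabilityMeasure_cond
  obtain ⟨c, hc, hle⟩ := t.exists_le_selProb hI ε
  have hreal : ∀ {Q : ∀ n, Measure (Ω n)} [∀ n, IsProbabilityMeasure (Q n)]
      {A : ∀ n, Set (Ω n)}, Tendsto (fun n => Q n (A n)) atTop (𝓝 0) ↔
        Tendsto (fun n => (Q n).real (A n)) atTop (𝓝 0) := fun {Q} _ {A} => by
    rw [← ENNReal.toReal_zero]
    exact (ENNReal.tendsto_toReal_iff (fun n => measure_ne_top _ _) ENNReal.zero_ne_top).symm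
  have hcondlim : ∀ {A : ∀ n, Set (Ω n)}, Tendsto (fun n => (P n).real (A n)) atTop (𝓝 0) →
      Tendsto (fun n => (P n)[|t.observed (S n)].real (A n)) atTop (𝓝 0) := fun {A} hA => by
    refine squeeze_zero (fun n => measureReal_nonneg) (fun n => (hmodel n).cond_real_le hc
      ((hmodel n).le_measureReal_observed (hle n (X n))) (A n)) ?_
    simpa using hA.div_const c
  refine ⟨fun δ hδ => hreal.2 (hcondlim (hreal.1 (hσ δ hδ))), hcond, ?_⟩
  have hU := (TreeInference.TreeFit.tendstoInDistribution_standardized hmodel hgrowth hparams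
    hI).continuous_comp TreeInference.continuous_stdCDF
  have hV := TreeInference.tendstoInDistribution_of_sub_tendsto_zero hU
    (V := fun n ω => t.pivot I ε (X n)
      (t.mainStat (X n) fun i => Y n i ω) (t.restStat (X n) fun i => Y n i ω)
      (√(TreeInference.count (X n) (t.leaf 0)) * π n 0) (σ2hat n ω))
    (fun n => (TreeInference.TreeFit.IsModel.measurable_pivot t (hmodel n) hI.continuousOn
      (hσ_meas n) _).aemeasurable)
    (fun δ hδ => hcondlim (TreeInference.TreeFit.tendsto_pivot_sub_stdCDF hmodel hgrowth hparams hI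
      (fun δ hδ => hreal.1 (hσ δ hδ)) hδ))
  refine ⟨hV.forall_aemeasurable, measurable_subtype_coe.aemeasurable, ?_⟩
  -- The two limit variables live on different spaces, but both have Lebesgue measure on [0, 1] as
  -- their law.
  convert hV.tendsto using 2
  refine congrArg 𝓝 (Subtype.ext ?_)
  change (volume : Measure unitInterval).map Subtype.val =
    (gaussianReal 0 1).map (TreeInference.stdCDF ∘ id)
  rw [Function.comp_id, TreeInference.map_stdCDF, unitInterval.measurePreserving_coe.map_eq]
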